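/- Let $\mathbf{M}$ be a complete and cocomplete closed symmetric monoidal category with unit $I$. A *bipointed single-colored operad* $\mathcal{P}^{(r_1,r_2)}$ is a single-colored symmetric operad $\mathcal{P}$ with values in $\mathbf{M}$ together with two arity-two operations $r_1,r_2 : I\to \mathcal{P}(2)$; a morphism $\phi:\mathcal{P}^{(r_1,r_2)}\to\mathcal{Q}^{(s_1,s_2)}$ is an operad morphism $\phi:\mathcal{P}\to\mathcal{Q}$ with $\phi\, r_i=s_i$ for $i=1,2$. An *orthogonal category* $\overline{\mathbf{C}}=(\mathbf{C},\perp)$ is a small category $\mathbf{C}$ with a symmetric relation $\perp$ on pairs of morphisms with common target such that $f_1\perp f_2$ implies $g f_1 h_1\perp g f_2 h_2$ for all composable $g,h_1,h_2$. The category $\mathbf{FT}(\overline{\mathbf{C}},\mathcal{P}^{(r_1,r_2)})$ of *field theories* is the full subcategory of the category of functors $\mathfrak{A}:\mathbf{C}\to\mathbf{Alg}_{\mathcal{P}}$ on those for which, for all $(f_1:c_1\to c)\perp(f_2:c_2\to c)$, the composites $$I\otimes\mathfrak{A}(c_1)\otimes\mathfrak{A}(c_2)\xrightarrow{\;r_i\otimes\mathfrak{A}(f_1)\otimes\mathfrak{A}(f_2)\;}\mathcal{P}(2)\otimes\mathfrak{A}(c)^{\otimes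 2}\longrightarrow\mathfrak{A}(c),\qquad i=1,2,$$ with the $\mathcal{P}$-action on $\mathfrak{A}(c)$ agree. Let $\phi:\mathcal{P}^{(r_1,r_2)}\to\mathcal{Q}^{(s_1,s_2)}$ be a morphism of bipointed single-colored operads, and let $j:\overline{\mathbf{C}}\to\overline{\mathbf{D}}$ be a full orthogonal subcategory, i.e. (the embedding of a full subcategory, or more generally) a fully faithful functor such that $f_1\perp_{\mathbf{C}}f_2$ if and only if $j(f_1)\perp_{\mathbf{D}}j(f_2)$. Let $W$ be a set of morphisms of $\mathbf{C}$. Post-composition with the pullback functor $\phi^*:\mathbf{Alg}_{\mathcal{Q}}\to\mathbf{Alg}_{\mathcal{P}}$ gives functors $(\phi^*)_*:\mathbf{FT}(\overline{\mathbf{E}},\mathcal{Q}^{(s_1,s_2)})\to\mathbf{FT}(\overline{\mathbf{E}},\mathcal{P}^{(r_1,r_2)})$ for $\mathbf{E}=\mathbf{C},\mathbf{D}$, and pre-composition with $j$ gives functors $j^*:\mathbf{FT}(\overline{\mathbf{D}},\mathcal{O})\to\mathbf{FT}(\overline{\mathbf{C}},\mathcal{O})$ for $\mathcal{O}=\mathcal{P}^{(r_1,r_2)},\mathcal{Q}^{(s_1,s_2)}$.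 All of these functors have left adjoints, denoted $(\phi^*)^!$ and $j_!$ respectively. A field theory $\mathfrak{A}$ on $\overline{\mathbf{D}}$ is called *$j$-local* if the counit $j_!\,j^*(\mathfrak{A})\to\mathfrak{A}$ is an isomorphism; a field theory $\mathfrak{A}$ on $\overline{\mathbf{C}}$ is called *$W$-constant* if $\mathfrak{A}(f)$ is an isomorphism for every $f\in W$. Then: a) The left adjoint $(\phi^*)^!:\mathbf{FT}(\overline{\mathbf{D}},\mathcal{P}^{(r_1,r_2)})\to\mathbf{FT}(\overline{\mathbf{D}},\mathcal{Q}^{(s_1,s_2)})$ maps $j$-local field theories to $j$-local field theories. b) The right adjoint $(\phi^*)_*:\mathbf{FT}(\overline{\mathbf{C}},\mathcal{Q}^{(s_1,s_2)})\to\mathbf{FT}(\overline{\mathbf{C}},\mathcal{P}^{(r_1,r_2)})$ maps $W$-constant field theories to $W$-constant field theories. -/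

import Mathlib

open CategoryTheory MonoidalCategory Limits

universe v u

namespace OperadicFT

/-! ### Ordered tensor products of finite families -/

section Tensor

variable {M : Type u} [Category.{v} M] [MonoidalCategory M]

/-- The tensor product `X a₁ ⊗ (X a₂ ⊗ (⋯ ⊗ (X aₙ ⊗ 𝟙_)))` of a family `X` along a list
`[a₁, …, aₙ]` of indices. -/
@[reducible]
def tens {ι : Type} (X : ι → M) : List ι → M
  | [] => 𝟙_ M
  | a :: l => X a ⊗ tens X l

/-- Functoriality of `tens` in the family. -/
def tensMap {ι : Type} {X Y : ι → M} (f : ∀ i, X i ⟶ Y i) :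
    (l : List ι) → (tens X l ⟶ tens Y l)
  | [] => 𝟙 _
  | a :: l => f a ⊗ₘ tensMap f l

/-- The tensor product of a family of morphisms `𝟙_ ⟶ X i`. -/
def tensElt {ι : Type} {X : ι → M} (x : ∀ i, 𝟙_ M ⟶ X i) :
    (l : List ι) → (𝟙_ M ⟶ tens X l)
  | [] => 𝟙 _
  | a :: l => (λ_ (𝟙_ M)).inv ≫ (x a ⊗ₘ tensElt x l)

/-- The canonical morphism (an iterated associator) for concatenated lists. -/
def tensAppend {ι : Type} (X : ι → M) :
    (l l' : List ι) → (tens X l ⊗ tens X l' ⟶ tens X (l ++ l'))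
  | [], l' => (λ_ (tens X l')).hom
  | a :: l, l' => (α_ (X a) (tens X l) (tens X l')).hom ≫ X a ◁ tensAppend X l l'

/-- The tensor product of `X ∘ e` along `l` is that of `X` along `l.map e`. -/
def tensToMap {ι κ : Type} (X : ι → M) (e : κ → ι) :
    (l : List κ) → (tens (fun k => X (e k)) l ⟶ tens X (l.map e))
  | [] => 𝟙 _
  | a :: l => X (e a) ◁ tensToMap X e l

/-- The inverse of `tensToMap`. -/
def tensFromMap {ι κ : Type} (X : ι → M) (e : κ → ι) :
    (l : List κ) → (tens X (l.map e) ⟶ tens (fun k => X (e k)) l)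
  | [] => 𝟙 _
  | a :: l => X (e a) ◁ tensFromMap X e l

/-- The canonical morphism from an iterated tensor product to a single one,
in lexicographic order. -/
def tensSigma {ι : Type} {κ : ι → Type} (X : ∀ i, κ i → M) (K : ∀ i, List (κ i)) :
    (l : List ι) → (tens (fun i => tens (X i) (K i)) l ⟶
      tens (fun p : (i : ι) × κ i => X p.1 p.2) (l.sigma K))
  | [] => 𝟙 _
  | i :: l => (tensToMap (fun p : (i : ι) × κ i => X p.1 p.2) (Sigma.mk i) (K i) ⊗ₘ
      tensSigma X K l) ≫ tensAppend _ _ _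

lemma tensMap_id {ι : Type} (X : ι → M) (l : List ι) :
    tensMap (fun i => 𝟙 (X i)) l = 𝟙 (tens X l) := by
  induction l with
  | nil => rfl
  | cons a l ih => simp [tensMap, ih, tens]

lemma tensMap_comp {ι : Type} {X Y Z : ι → M} (f : ∀ i, X i ⟶ Y i) (g : ∀ i, Y i ⟶ Z i)
    (l : List ι) : tensMap (fun i => f i ≫ g i) l = tensMap f l ≫ tensMap g l := by
  induction l with
  | nil => simp [tensMap]
  | cons a l ih => simp [tensMap, ih]

variable [SymmetricCategory M]

/-- The shuffle `⨂ (X i ⊗ Y i) ⟶ (⨂ X i) ⊗ (⨂ Y i)`. -/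
def tensZip {ι : Type} (X Y : ι → M) :
    (l : List ι) → (tens (fun i => X i ⊗ Y i) l ⟶ tens X l ⊗ tens Y l)
  | [] => (λ_ (𝟙_ M)).inv
  | a :: l => (X a ⊗ Y a) ◁ tensZip X Y l ≫ tensorμ (X a) (Y a) (tens X l) (tens Y l)

/-- Moving the (first) factor indexed by `a` to the front, by means of the braiding. -/
def tensPull {ι : Type} [DecidableEq ι] (X : ι → M) (a : ι) :
    (l : List ι) → a ∈ l → (tens X l ⟶ X a ⊗ tens X (l.erase a))
  | [], h => absurd h List.not_mem_nil
  | b :: l, h =>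
    if hb : b = a then
      eqToHom (by subst hb; rw [List.erase_cons_head])
    else
      X b ◁ tensPull X a l ((List.mem_cons.1 h).resolve_left (Ne.symm hb)) ≫
        (α_ (X b) (X a) (tens X (l.erase a))).inv ≫
        (β_ (X b) (X a)).hom ▷ tens X (l.erase a) ≫
        (α_ (X a) (X b) (tens X (l.erase a))).hom ≫
        X a ◁ eqToHom (by rw [List.erase_cons_tail (by simpa using hb)])

/-- The symmetry isomorphism between the tensor products along two lists that are permutations of
each other. It is the expected one if the lists have no duplicates, the only case used below. -/
def tensPerm {ι : Type} [DecidableEq ι] (X : ι → M) :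
    (l l' : List ι) → l.Perm l' → (tens X l ⟶ tens X l')
  | l, [], h => eqToHom (by rw [h.eq_nil])
  | l, a :: l', h =>
    tensPull X a l (h.mem_iff.2 List.mem_cons_self) ≫
      X a ◁ tensPerm X (l.erase a) l'
        (List.cons_perm_iff_perm_erase.1 h.symm).2.symm

/-- The tensor product `X 0 ⊗ ⋯ ⊗ X (n-1)`. -/
abbrev finTens {n : ℕ} (X : Fin n → M) : M := tens X (List.finRange n)

/-- The tensor power `A ⊗ ⋯ ⊗ A`. -/
abbrev tensPow (n : ℕ) (A : M) : M := finTens (fun _ : Fin n => A)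

/-- The identification of `A` with its first tensor power. -/
def tensOne (A : M) : A ⟶ tensPow 1 A := (ρ_ A).inv

/-- The identification of `A ⊗ A` with the second tensor power. -/
def tensTwo (A : M) : A ⊗ A ⟶ tensPow 2 A := A ◁ (ρ_ A).inv

/-- The permutation `⨂ᵢ X i ⟶ ⨂ᵢ X (σ i)` of tensor factors. -/
def finTensPerm {n : ℕ} (σ : Equiv.Perm (Fin n)) (X : Fin n → M) :
    finTens X ⟶ finTens (fun i => X (σ i)) :=
  tensPerm X (List.finRange n) ((List.finRange n).map σ)
      (by
        refine (List.perm_ext_iff_of_nodup (List.nodup_finRange n)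
          ((List.nodup_finRange n).map σ.injective)).2 fun i => ?_
        simp only [List.mem_finRange, List.mem_map, true_and, true_iff]
        exact ⟨σ.symm i, σ.apply_symm_apply i⟩) ≫
    tensFromMap X σ (List.finRange n)

/-- The canonical morphism `⨂ᵢ ⨂ⱼ X i j ⟶ ⨂ₐ X aᵢ aⱼ`, where `a` enumerates the pairs `(i, j)`
lexicographically. -/
def finTensFlatten {n : ℕ} {k : Fin n → ℕ} (X : ∀ i, Fin (k i) → M) :
    finTens (fun i => finTens (X i)) ⟶
      finTens (fun a : Fin (∑ i, k i) =>
        X (finSigmaFinEquiv.symm a).1 (finSigmaFinEquiv.symm a).2) :=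
  tensSigma X (fun i => List.finRange (k i)) (List.finRange n) ≫
    tensPerm (fun p : (i : Fin n) × Fin (k i) => X p.1 p.2)
      ((List.finRange n).sigma fun i => List.finRange (k i))
      ((List.finRange (∑ i, k i)).map finSigmaFinEquiv.symm)
      (by
        refine (List.perm_ext_iff_of_nodup
          ((List.nodup_finRange n).sigma fun i => List.nodup_finRange (k i))
          ((List.nodup_finRange _).map finSigmaFinEquiv.symm.injective)).2 fun p => ?_
        refine iff_of_true ?_ (List.mem_map.2 ⟨finSigmaFinEquiv p, List.mem_finRange _,
          finSigmaFinEquiv.symm_apply_apply p⟩)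
        exact List.mem_sigma.2 ⟨List.mem_finRange _, List.mem_finRange _⟩) ≫
    tensFromMap (fun p : (i : Fin n) × Fin (k i) => X p.1 p.2) finSigmaFinEquiv.symm
      (List.finRange (∑ i, k i))

/-- The shuffle `⨂ᵢ (X i ⊗ Y i) ⟶ (⨂ᵢ X i) ⊗ (⨂ᵢ Y i)`. -/
abbrev finTensZip {n : ℕ} (X Y : Fin n → M) :
    finTens (fun i => X i ⊗ Y i) ⟶ finTens X ⊗ finTens Y :=
  tensZip X Y (List.finRange n)

lemma tensZip_natural {ι : Type} {X X' Y Y' : ι → M} (f : ∀ i, X i ⟶ X' i)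
    (g : ∀ i, Y i ⟶ Y' i) (l : List ι) :
    tensMap (fun i => f i ⊗ₘ g i) l ≫ tensZip X' Y' l =
      tensZip X Y l ≫ (tensMap f l ⊗ₘ tensMap g l) := by
  induction l with
  | nil => simp [tensMap, tensZip]
  | cons a l ih =>
    simp only [tensMap, tensZip, Category.assoc]
    rw [← tensorμ_natural, ← MonoidalCategory.id_tensorHom,
      ← MonoidalCategory.id_tensorHom, MonoidalCategory.tensorHom_comp_tensorHom_assoc,
      MonoidalCategory.tensorHom_comp_tensorHom_assoc, ih, Category.comp_id, Category.id_comp]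

end Tensor

/-! ### Single-colored operads -/

section Operads

/-- The block permutation of `k (σ 0) + k (σ 1) + ⋯` letters induced by `σ`, sending the `j`-th
letter of the `i`-th block to the `j`-th letter of the `σ i`-th block. -/
def blockPerm {n : ℕ} (σ : Equiv.Perm (Fin n)) (k : Fin n → ℕ) :
    Fin (∑ i, k (σ i)) ≃ Fin (∑ i, k i) :=
  (finSigmaFinEquiv (n := fun i => k (σ i))).symm.trans
    ((Equiv.sigmaCongrLeft (β := fun i => Fin (k i)) σ).trans finSigmaFinEquiv)

/-- `blockPerm` as a permutation of `k 0 + k 1 + ⋯` letters. -/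
def blockPerm' {n : ℕ} (σ : Equiv.Perm (Fin n)) (k : Fin n → ℕ) :
    Equiv.Perm (Fin (∑ i, k i)) :=
  (finCongr (Equiv.sum_comp σ k).symm).trans (blockPerm σ k)

/-- The block sum `τ 0 ⊕ τ 1 ⊕ ⋯` of permutations. -/
def sumPerm {n : ℕ} {k : Fin n → ℕ} (τ : ∀ i, Equiv.Perm (Fin (k i))) :
    Equiv.Perm (Fin (∑ i, k i)) :=
  finSigmaFinEquiv.symm.trans ((Equiv.sigmaCongrRight τ).trans finSigmaFinEquiv)

/-- The lengths of the inner blocks, enumerated lexicographically. -/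
abbrev flatLen {n : ℕ} {k : Fin n → ℕ} (l : ∀ i, Fin (k i) → ℕ) (a : Fin (∑ i, k i)) : ℕ :=
  l (finSigmaFinEquiv.symm a).1 (finSigmaFinEquiv.symm a).2

lemma sum_flatLen {n : ℕ} {k : Fin n → ℕ} (l : ∀ i, Fin (k i) → ℕ) :
    ∑ a, flatLen l a = ∑ i, ∑ j, l i j := by
  rw [← Fintype.sum_sigma']
  exact Equiv.sum_comp finSigmaFinEquiv.symm (fun p : (i : Fin n) × Fin (k i) => l p.1 p.2)

variable (M : Type u) [Category.{v} M] [MonoidalCategory M] [SymmetricCategory M]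

/-- A single-colored (symmetric) operad with values in `M`: objects of operations `ob n`, a right
action of the permutation groups, operadic compositions and an operadic unit, subject to the usual
axioms. For `n = 0` the composition is forced by `unit_right` to be the right unitor. -/
structure Operad where
  /-- the object `P(n)` of operations of arity `n` -/
  ob : ℕ → M
  /-- the permutation action `P(σ)`: in terms of elements, `x ↦ x · σ` -/
  perm : ∀ {n : ℕ}, Equiv.Perm (Fin n) → (ob n ⟶ ob n)
  /-- the operadic composition -/
  comp : ∀ {n : ℕ} (k : Fin n → ℕ), ob n ⊗ finTens (fun i => ob (k i)) ⟶ ob (∑ i, k i)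
  /-- the operadic unit -/
  unit : 𝟙_ M ⟶ ob 1
  perm_one : ∀ n : ℕ, perm (1 : Equiv.Perm (Fin n)) = 𝟙 (ob n)
  perm_mul : ∀ {n : ℕ} (σ τ : Equiv.Perm (Fin n)), perm (σ * τ) = perm σ ≫ perm τ
  /-- `γ(x · σ; y_{σ 0}, y_{σ 1}, …) = γ(x; y₀, y₁, …) · σ⟨k₀, k₁, …⟩` -/
  comp_perm : ∀ {n : ℕ} (σ : Equiv.Perm (Fin n)) (k : Fin n → ℕ),
    (perm σ ⊗ₘ finTensPerm σ (fun i => ob (k i))) ≫ comp (fun i => k (σ i)) =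
      comp k ≫ perm (blockPerm' σ k) ≫ eqToHom (congrArg ob (Equiv.sum_comp σ k).symm)
  /-- `γ(x; y₀ · τ₀, y₁ · τ₁, …) = γ(x; y₀, y₁, …) · (τ₀ ⊕ τ₁ ⊕ ⋯)` -/
  comp_sumPerm : ∀ {n : ℕ} {k : Fin n → ℕ} (τ : ∀ i, Equiv.Perm (Fin (k i))),
    ob n ◁ tensMap (fun i => perm (τ i)) (List.finRange n) ≫ comp k = comp k ≫ perm (sumPerm τ)
  /-- `γ(x; γ(y₀; z₀₀, …), γ(y₁; z₁₀, …), …) = γ(γ(x; y₀, y₁, …); z₀₀, …, z₁₀, …)` -/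
  assoc : ∀ {n : ℕ} {k : Fin n → ℕ} (l : ∀ i, Fin (k i) → ℕ),
    ob n ◁ tensMap (fun i => comp (l i)) (List.finRange n) ≫ comp (fun i => ∑ j, l i j) =
      ob n ◁ finTensZip (fun i => ob (k i)) (fun i => finTens fun j => ob (l i j)) ≫
        (α_ _ _ _).inv ≫
        (comp k ⊗ₘ finTensFlatten (fun i j => ob (l i j))) ≫
        comp (flatLen l) ≫ eqToHom (congrArg ob (sum_flatLen l))
  /-- `γ(1; x) = x` -/
  unit_left : ∀ k : ℕ,
    (λ_ (ob k)).inv ≫ (unit ⊗ₘ tensOne (ob k)) ≫ comp (fun _ : Fin 1 => k) =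
      eqToHom (congrArg ob (by simp))
  /-- `γ(x; 1, …, 1) = x` -/
  unit_right : ∀ n : ℕ,
    (ρ_ (ob n)).inv ≫ ob n ◁ tensElt (fun _ => unit) (List.finRange n) ≫
      comp (fun _ : Fin n => 1) = eqToHom (congrArg ob (by simp))

variable {M}

/-- A morphism of single-colored operads. -/
@[ext]
structure Operad.Hom (P Q : Operad M) where
  app : ∀ n : ℕ, P.ob n ⟶ Q.ob n
  perm : ∀ {n : ℕ} (σ : Equiv.Perm (Fin n)), P.perm σ ≫ app n = app n ≫ Q.perm σ
  comp : ∀ {n : ℕ} (k : Fin n → ℕ),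
    P.comp k ≫ app (∑ i, k i) =
      (app n ⊗ₘ tensMap (fun i => app (k i)) (List.finRange n)) ≫ Q.comp k
  unit : P.unit ≫ app 1 = Q.unit

/-- An algebra over a single-colored operad. -/
structure Alg (P : Operad M) where
  /-- the underlying object -/
  carrier : M
  /-- the action of the operad -/
  act : ∀ n : ℕ, P.ob n ⊗ tensPow n carrier ⟶ carrier
  assoc : ∀ {n : ℕ} (k : Fin n → ℕ),
    P.ob n ◁ tensMap (fun i => act (k i)) (List.finRange n) ≫ act n =
      P.ob n ◁ finTensZip (fun i => P.ob (k i)) (fun i => tensPow (k i) carrier) ≫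
        (α_ _ _ _).inv ≫
        (P.comp k ⊗ₘ finTensFlatten (fun (i : Fin n) (_ : Fin (k i)) => carrier)) ≫
        act (∑ i, k i)
  unit : (λ_ carrier).inv ≫ (P.unit ⊗ₘ tensOne carrier) ≫ act 1 = 𝟙 carrier
  equivariance : ∀ {n : ℕ} (σ : Equiv.Perm (Fin n)),
    (P.perm σ ⊗ₘ finTensPerm σ (fun _ => carrier)) ≫ act n = act n

namespace Alg

/-- A morphism of algebras over a single-colored operad. -/
@[ext]
structure Hom {P : Operad M} (A B : Alg P) where
  hom : A.carrier ⟶ B.carrier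
  act_hom : ∀ n : ℕ,
    A.act n ≫ hom = P.ob n ◁ tensMap (fun _ => hom) (List.finRange n) ≫ B.act n

/-- The category of algebras over a single-colored operad. -/
instance category (P : Operad M) : Category.{v} (Alg P) where
  Hom A B := Hom A B
  id A := ⟨𝟙 _, fun n => by simp [tensMap_id]⟩
  comp f g := ⟨f.hom ≫ g.hom, fun n => by
    rw [← Category.assoc, f.act_hom, Category.assoc, g.act_hom, tensMap_comp]
    simp⟩

@[ext]
lemma hom_ext {P : Operad M} {A B : Alg P} (f g : A ⟶ B) (h : f.hom = g.hom) : f = g :=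
  Hom.ext h

@[simp]
lemma id_hom {P : Operad M} (A : Alg P) : Hom.hom (𝟙 A) = 𝟙 A.carrier := rfl

@[simp]
lemma comp_hom {P : Operad M} {A B C : Alg P} (f : A ⟶ B) (g : B ⟶ C) :
    (f ≫ g).hom = f.hom ≫ g.hom := rfl

end Alg

/-- The pullback of an algebra along a morphism `φ` of operads. -/
def Alg.pullback {P Q : Operad M} (φ : Operad.Hom P Q) (A : Alg Q) : Alg P where
  carrier := A.carrier
  act n := φ.app n ▷ tensPow n A.carrier ≫ A.act n
  assoc := by
    intro n k
    have h1 : tensMap (fun i => φ.app (k i) ▷ tensPow (k i) A.carrier ≫ A.act (k i))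
        (List.finRange n) =
        tensMap (fun i => φ.app (k i) ⊗ₘ 𝟙 (tensPow (k i) A.carrier)) (List.finRange n) ≫
          tensMap (fun i => A.act (k i)) (List.finRange n) := by
      rw [← tensMap_comp]; simp
    have h2 := tensZip_natural (fun i => φ.app (k i))
      (fun i => 𝟙 (tensPow (k i) A.carrier)) (List.finRange n)
    rw [tensMap_id, MonoidalCategory.tensorHom_id] at h2
    have h3 := φ.comp k
    have h4 := A.assoc k
    calc _ = (φ.app n ⊗ₘ tensMap (fun i => φ.app (k i) ⊗ₘ 𝟙 (tensPow (k i) A.carrier))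
              (List.finRange n)) ≫
            Q.ob n ◁ tensMap (fun i => A.act (k i)) (List.finRange n) ≫ A.act n := by
          rw [h1, MonoidalCategory.tensorHom_def']
          simp only [MonoidalCategory.whiskerLeft_comp, Category.assoc,
            MonoidalCategory.whisker_exchange_assoc]
      _ = P.ob n ◁ finTensZip (fun i => P.ob (k i)) (fun i => tensPow (k i) A.carrier) ≫
            (φ.app n ⊗ₘ (tensMap (fun i => φ.app (k i)) (List.finRange n) ▷
              finTens (fun i => tensPow (k i) A.carrier))) ≫
            (α_ _ _ _).inv ≫
            (Q.comp k ⊗ₘ finTensFlatten (fun (i : Fin n) (_ : Fin (k i)) => A.carrier)) ≫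
            A.act (∑ i, k i) := by
          rw [h4, MonoidalCategory.tensorHom_def', MonoidalCategory.tensorHom_def']
          simp only [Category.assoc, ← MonoidalCategory.whisker_exchange_assoc]
          rw [← MonoidalCategory.whiskerLeft_comp_assoc, h2]
          simp only [MonoidalCategory.whiskerLeft_comp, Category.assoc]
          rw [MonoidalCategory.tensorHom_def (φ.app n), Category.assoc,
            MonoidalCategory.whisker_exchange_assoc]
      _ = _ := by
          congr 1
          rw [← MonoidalCategory.tensorHom_id, MonoidalCategory.associator_inv_naturality_assoc,
            MonoidalCategory.tensorHom_comp_tensorHom_assoc, ← h3, Category.id_comp,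
            MonoidalCategory.tensorHom_def, MonoidalCategory.tensorHom_def]
          simp only [MonoidalCategory.comp_whiskerRight, Category.assoc,
            MonoidalCategory.whisker_exchange_assoc]
  unit := by
    have h := A.unit
    rw [← φ.unit] at h
    rw [← h]
    simp only [MonoidalCategory.tensorHom_def, MonoidalCategory.comp_whiskerRight, Category.assoc,
      MonoidalCategory.whisker_exchange_assoc]
  equivariance := by
    intro n σ
    conv_rhs => rw [← A.equivariance σ]
    rw [MonoidalCategory.tensorHom_def, MonoidalCategory.tensorHom_def, Category.assoc,
      Category.assoc, MonoidalCategory.whisker_exchange_assoc,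
      ← MonoidalCategory.comp_whiskerRight_assoc,
      ← MonoidalCategory.comp_whiskerRight_assoc, φ.perm σ]

/-- The pullback functor `φ^*` on algebras along a morphism `φ` of operads. -/
def pullbackAlg {P Q : Operad M} (φ : Operad.Hom P Q) : Alg Q ⥤ Alg P where
  obj A := A.pullback φ
  map {A B} f :=
    { hom := f.hom
      act_hom := fun n => by
        have h := f.act_hom n
        simp only [Alg.pullback, Category.assoc]
        rw [h, MonoidalCategory.whisker_exchange_assoc] }

variable (M) in
/-- An (arity `2`) bipointed single-colored operad: an operad `P` with two operations
`r₁, r₂ : 𝟙_ ⟶ P(2)` of arity two. -/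
structure BipointedOperad extends Operad M where
  r₁ : 𝟙_ M ⟶ ob 2
  r₂ : 𝟙_ M ⟶ ob 2

/-- A morphism of bipointed single-colored operads. -/
@[ext]
structure BipointedOperad.Hom (P Q : BipointedOperad M) extends
    Operad.Hom P.toOperad Q.toOperad where
  map_r₁ : P.r₁ ≫ app 2 = Q.r₁
  map_r₂ : P.r₂ ≫ app 2 = Q.r₂

end Operads

/-! ### Orthogonal categories -/

/-- An orthogonality relation on a category: a symmetric relation on pairs of morphisms with
common target that is stable under composition. -/
structure Orthogonality (C : Type v) [SmallCategory C] where
  /-- `rel f₁ f₂` means `f₁ ⊥ f₂` -/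
  rel : ∀ {c₁ c₂ c : C}, (c₁ ⟶ c) → (c₂ ⟶ c) → Prop
  symm : ∀ {c₁ c₂ c : C} (f₁ : c₁ ⟶ c) (f₂ : c₂ ⟶ c), rel f₁ f₂ → rel f₂ f₁
  comp : ∀ {c₁ c₂ c b₁ b₂ d : C} (f₁ : c₁ ⟶ c) (f₂ : c₂ ⟶ c) (g : c ⟶ d) (h₁ : b₁ ⟶ c₁)
    (h₂ : b₂ ⟶ c₂), rel f₁ f₂ → rel (h₁ ≫ f₁ ≫ g) (h₂ ≫ f₂ ≫ g)

/-- A full orthogonal subcategory, given by its embedding: a fully faithful functor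
`j : C ⥤ D` such that `⊥_C` is the pullback of `⊥_D` along `j`. -/
structure IsFullOrthogonalSubcategory {C D : Type v} [SmallCategory C] [SmallCategory D]
    (oC : Orthogonality C) (oD : Orthogonality D) (j : C ⥤ D) : Prop where
  full : j.Full
  faithful : j.Faithful
  rel_iff : ∀ {c₁ c₂ c : C} (f₁ : c₁ ⟶ c) (f₂ : c₂ ⟶ c),
    oC.rel f₁ f₂ ↔ oD.rel (j.map f₁) (j.map f₂)

/-! ### Field theories -/

section FieldTheories

variable {M : Type u} [Category.{v} M] [MonoidalCategory M] [SymmetricCategory M]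

/-- The condition that a functor `𝔄 : C ⥤ Alg P` is a field theory: for all
`(f₁ : c₁ ⟶ c) ⊥ (f₂ : c₂ ⟶ c)`, the two composites
`𝟙_ ⊗ (𝔄 c₁ ⊗ 𝔄 c₂) ⟶ P(2) ⊗ (𝔄 c)^{⊗ 2} ⟶ 𝔄 c` given by `rᵢ ⊗ 𝔄 f₁ ⊗ 𝔄 f₂` and the action
of `P` are equal. -/
def isFieldTheory {C : Type v} [SmallCategory C] (oC : Orthogonality C)
    (P : BipointedOperad M) : ObjectProperty (C ⥤ Alg P.toOperad) := fun 𝔄 =>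
  ∀ ⦃c₁ c₂ c : C⦄ (f₁ : c₁ ⟶ c) (f₂ : c₂ ⟶ c), oC.rel f₁ f₂ →
    (P.r₁ ⊗ₘ (((𝔄.map f₁).hom ⊗ₘ (𝔄.map f₂).hom) ≫ tensTwo (𝔄.obj c).carrier)) ≫
        (𝔄.obj c).act 2 =
      (P.r₂ ⊗ₘ (((𝔄.map f₁).hom ⊗ₘ (𝔄.map f₂).hom) ≫ tensTwo (𝔄.obj c).carrier)) ≫
        (𝔄.obj c).act 2

/-- The category `FT(C, P)` of field theories, a full subcategory of `C ⥤ Alg P`. -/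
abbrev FT {C : Type v} [SmallCategory C] (oC : Orthogonality C) (P : BipointedOperad M) :=
  (isFieldTheory oC P).FullSubcategory

/-- The functor `(φ^*)_* = φ^* ∘ (-) : FT(C, Q) ⥤ FT(C, P)`. -/
def changeOperad {C : Type v} [SmallCategory C] (oC : Orthogonality C)
    {P Q : BipointedOperad M} (φ : BipointedOperad.Hom P Q) : FT oC Q ⥤ FT oC P :=
  (isFieldTheory oC P).lift
    ((isFieldTheory oC Q).ι ⋙ (Functor.whiskeringRight C _ _).obj (pullbackAlg φ.toHom))
    (fun 𝔄 c₁ c₂ c f₁ f₂ h => by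
      have h' := 𝔄.property f₁ f₂ h
      rw [← φ.map_r₁, ← φ.map_r₂] at h'
      have key : ∀ {X Y : M} (r : 𝟙_ M ⟶ P.ob 2) (g : X ⟶ Y),
          (r ⊗ₘ g) ≫ φ.app 2 ▷ Y = (r ≫ φ.app 2) ⊗ₘ g := fun r g => by
        rw [← MonoidalCategory.tensorHom_id, MonoidalCategory.tensorHom_comp_tensorHom,
          Category.comp_id]
      rw [← key, ← key, Category.assoc, Category.assoc] at h'
      exact h')

/-- The restriction functor `j^* = (-) ∘ j : FT(D, P) ⥤ FT(C, P)` along a full orthogonal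
subcategory `j`. -/
def restrict {C D : Type v} [SmallCategory C] [SmallCategory D]
    {oC : Orthogonality C} {oD : Orthogonality D} {j : C ⥤ D}
    (hj : IsFullOrthogonalSubcategory oC oD j) (P : BipointedOperad M) : FT oD P ⥤ FT oC P :=
  (isFieldTheory oC P).lift
    ((isFieldTheory oD P).ι ⋙ (Functor.whiskeringLeft C D _).obj j)
    (fun 𝔄 _ _ _ f₁ f₂ h => 𝔄.property (j.map f₁) (j.map f₂) ((hj.rel_iff f₁ f₂).1 h))

/-- A field theory `𝔄` on `D` is `j`-local if the counit `j_! j^* 𝔄 ⟶ 𝔄` of the adjunction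
`j_! ⊣ j^*` is an isomorphism. (Left adjoints being unique up to a unique isomorphism, this does
not depend on the choice of the adjunction.) -/
def IsLocal {C D : Type v} [SmallCategory C] [SmallCategory D]
    {oC : Orthogonality C} {oD : Orthogonality D} {j : C ⥤ D}
    (hj : IsFullOrthogonalSubcategory oC oD j) {P : BipointedOperad M} (𝔄 : FT oD P) : Prop :=
  ∃ (L : FT oC P ⥤ FT oD P) (adj : L ⊣ restrict hj P), IsIso (adj.counit.app 𝔄)

/-- A field theory `𝔄` on `C` is `W`-constant if `𝔄 f` is an isomorphism of algebras for every
`f` in `W`. -/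
def IsConstantOn {C : Type v} [SmallCategory C] {oC : Orthogonality C} {P : BipointedOperad M}
    (W : MorphismProperty C) (𝔄 : FT oC P) : Prop :=
  ∀ ⦃c c' : C⦄ (f : c ⟶ c'), W f → IsIso (𝔄.obj.map f)

end FieldTheories

end OperadicFT

universe w

namespace OperadicFT

/-! ### Sifted colimits and tensor powers -/

section Sifted

open WalkingReflexivePair WalkingReflexivePair.Hom

/-! Part b) holds because functors preserve isomorphisms. For part a), restriction along `j`
commutes on the nose with pullback along `φ`, so the left adjoints commute up to isomorphism:
`(φ^*)^! j_! ≅ j_! (φ^*)^!`. If `𝔄 ≅ j_! j^* 𝔄`, then `(φ^*)^! 𝔄 ≅ j_! (φ^*)^! j^* 𝔄` lies in the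
essential image of `j_!`, and it remains to see that the counit is invertible there. For this it
suffices that the unit of `j_! ⊣ j^*` is an epimorphism (`isIso_counit_app_of_epi_unit_app`): `j_!`
sends it to an epimorphism which is split mono by a triangle identity. That the unit is an
isomorphism is never needed.

The substance is thus the existence of the adjoints together with this epimorphy, and both come from
one construction by generators and relations (`exists_universal_arrow`). Given a field theory `X` on
`C`, take the left Kan extension along `j` of its underlying diagram in `M`, form objectwise the
free object with operations `Q(n) ⊗ (-)^{⊗ n}` and no equations, and divide out the algebra axioms,
the orthogonality conditions and the relations making the generators a map of `P`-algebras. Taking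
`j` or `φ` to be the identity gives the individual adjoints.

Two facts make the quotient tractable. The functors `Q(n) ⊗ (-)^{⊗ n}` preserve sifted colimits, in
particular reflexive coequalizers, so the quotient map is an epimorphism in `M` at every object of
`D`. Every axiom is an equation whose arity preserves such epimorphisms, so imposing it on the free
object already forces it on the quotient (`exists_model`). Finally, since `j` is fully faithful, the
Kan extension does not change values on `C`; hence at `j c` the quotient is generated by `X c`,
which gives the epimorphic unit. -/

lemma hom_zero_zero_eq (f f' : (zero : WalkingReflexivePair) ⟶ zero) : f = f' := by
  have h : ∀ e : WalkingReflexivePair.Hom zero zero, e = WalkingReflexivePair.Hom.id zero := by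
    rintro ⟨⟩; rfl
  exact (h f).trans (h f').symm

lemma hom_one_zero_cases (f : (one : WalkingReflexivePair) ⟶ zero) : f = left ∨ f = right := by
  have h : ∀ e : WalkingReflexivePair.Hom one zero, e = left ∨ e = right := by
    rintro (_ | _)
    exacts [Or.inl rfl, Or.inr rfl]
  exact h f

/-- When `a = one`, the object `(𝟙, g ≫ reflexion)` over `one` maps to both sides, via `f` and via
`f'`: the reflexion is a common section, so the second coordinate returns to `g` in either case. -/
lemma zigzag_reflexive_left {a b : WalkingReflexivePair} (f f' : a ⟶ zero) (g : b ⟶ zero) :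
    Zigzag (StructuredArrow.mk (T := Functor.diag WalkingReflexivePair) (S := (a, b)) (Y := zero)
      ((f, g) : (a, b) ⟶ (zero, zero)))
      (StructuredArrow.mk (Y := zero) ((f', g) : (a, b) ⟶ (zero, zero))) := by
  cases a with
  | zero => obtain rfl := hom_zero_zero_eq f f'; exact Relation.ReflTransGen.refl
  | one =>
    let m : StructuredArrow (one, b) (Functor.diag WalkingReflexivePair) :=
      StructuredArrow.mk (Y := one) ((𝟙 one, g ≫ reflexion) : (one, b) ⟶ (one, one))
    have h : ∀ e : one ⟶ zero, Zigzag m (StructuredArrow.mk (Y := zero)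
        ((e, g) : (one, b) ⟶ (zero, zero))) := by
      intro e
      refine Zigzag.of_hom (StructuredArrow.homMk e ?_)
      obtain rfl | rfl := hom_one_zero_cases e <;> exact Prod.ext (Category.id_comp _) (by simp [m])
    exact (h f).symm.trans (h f')

lemma zigzag_reflexive_right {a b : WalkingReflexivePair} (f : a ⟶ zero) (g g' : b ⟶ zero) :
    Zigzag (StructuredArrow.mk (T := Functor.diag WalkingReflexivePair) (S := (a, b)) (Y := zero)
      ((f, g) : (a, b) ⟶ (zero, zero)))
      (StructuredArrow.mk (Y := zero) ((f, g') : (a, b) ⟶ (zero, zero))) := by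
  cases b with
  | zero => obtain rfl := hom_zero_zero_eq g g'; exact Relation.ReflTransGen.refl
  | one =>
    let m : StructuredArrow (a, one) (Functor.diag WalkingReflexivePair) :=
      StructuredArrow.mk (Y := one) ((f ≫ reflexion, 𝟙 one) : (a, one) ⟶ (one, one))
    have h : ∀ e : one ⟶ zero, Zigzag m (StructuredArrow.mk (Y := zero)
        ((f, e) : (a, one) ⟶ (zero, zero))) := by
      intro e
      refine Zigzag.of_hom (StructuredArrow.homMk e ?_)
      obtain rfl | rfl := hom_one_zero_cases e <;> exact Prod.ext (by simp [m]) (Category.id_comp _)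
    exact (h g).symm.trans (h g')

/-- Every object of the comma category maps to one lying over `zero`; there the two coordinates can
be changed one at a time. This is what lets tensor powers commute with reflexive coequalizers. -/
instance isSifted_walkingReflexivePair : IsSifted WalkingReflexivePair where
  nonempty := ⟨zero⟩
  out := by
    rintro ⟨a, b⟩
    have toZero : ∀ c : WalkingReflexivePair, Nonempty (c ⟶ zero) := fun c => by
      cases c
      exacts [⟨𝟙 _⟩, ⟨left⟩]
    have : Nonempty (StructuredArrow (a, b) (Functor.diag WalkingReflexivePair)) :=
      ⟨StructuredArrow.mk (Y := zero) (((toZero a).some, (toZero b).some) : (a, b) ⟶ (zero, zero))⟩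
    have key : ∀ X : StructuredArrow (a, b) (Functor.diag WalkingReflexivePair),
        ∃ (f : a ⟶ zero) (g : b ⟶ zero), Zigzag X (StructuredArrow.mk (Y := zero)
          ((f, g) : (a, b) ⟶ (zero, zero))) := by
      rintro ⟨⟨⟨⟩⟩, c, f, g⟩
      obtain ⟨e⟩ := toZero c
      exact ⟨f ≫ e, g ≫ e, Zigzag.of_hom (StructuredArrow.homMk e rfl)⟩
    refine zigzag_isConnected fun X Y => ?_
    obtain ⟨f, g, h⟩ := key X
    obtain ⟨f', g', h'⟩ := key Y
    exact h.trans ((zigzag_reflexive_left f f' g).trans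
      ((zigzag_reflexive_right f' g g').trans h'.symm))

end Sifted

section TensorPowers

variable {M : Type u} [Category.{v} M] [MonoidalCategory M]

/-- The tensor power functor `X ↦ X ⊗ (X ⊗ ⋯)`, with one factor for each entry of `l`. -/
@[simps]
def tensFunctor {ι : Type} (l : List ι) : M ⥤ M where
  obj X := tens (fun _ => X) l
  map f := tensMap (fun _ => f) l
  map_id _ := tensMap_id _ l
  map_comp _ _ := tensMap_comp _ _ l

variable [SymmetricCategory M] [MonoidalClosed M]

instance preservesColimits_tensorRight (X : M) {J : Type*} [Category J] :
    PreservesColimitsOfShape J (tensorRight X) :=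
  preservesColimitsOfShape_of_natIso (BraidedCategory.tensorLeftIsoTensorRight X)

instance preservesColimit_curriedTensor {J : Type*} [Category J] (K K' : J ⥤ M) :
    PreservesColimit₂ K K' (curriedTensor M) := by
  have h₁ : ∀ X : M, PreservesColimit K ((curriedTensor M).flip.obj X) := fun X =>
    inferInstanceAs (PreservesColimit K (tensorRight X))
  have h₂ : ∀ X : M, PreservesColimit K' ((curriedTensor M).obj X) := fun X =>
    inferInstanceAs (PreservesColimit K' (tensorLeft X))
  infer_instance

/-- The tensor product preserves colimits in each variable separately, and siftedness allows the
resulting colimit over `J × J` to be computed along the diagonal. For the empty list the diagram is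
constant, and connectedness of `J` suffices. -/
instance preservesColimitsOfShape_tensFunctor {ι : Type} (l : List ι) {J : Type*} [Category J]
    [IsSifted J] : PreservesColimitsOfShape J (tensFunctor (M := M) l) := by
  induction l with
  | nil =>
    refine ⟨fun {K} => ⟨fun {c} hc => ⟨?_⟩⟩⟩
    exact (isColimitConstCocone J (𝟙_ M)).ofIsoColimit
      (Cocone.ext (Iso.refl _) (fun j => Category.comp_id _))
  | cons a l ih =>
    refine ⟨fun {K} => ⟨fun {c} hc => ⟨?_⟩⟩⟩
    exact (hc.tensor (isColimitOfPreserves (tensFunctor l) hc)).ofIsoColimit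
      (Cocone.ext (Iso.refl _) (fun j => Category.comp_id _))

lemma epi_tensorHom {X X' Y Y' : M} (f : X ⟶ X') (g : Y ⟶ Y') [Epi f] [Epi g] :
    Epi (f ⊗ₘ g) := by
  have h₁ : Epi (X' ◁ g) := inferInstanceAs (Epi ((tensorLeft X').map g))
  have h₂ : Epi (f ▷ Y) := by
    exact inferInstanceAs (Epi ((tensorRight Y).map f))
  rw [MonoidalCategory.tensorHom_def]
  exact epi_comp _ _

lemma epi_tensMap {ι : Type} {X Y : ι → M} (f : ∀ i, X i ⟶ Y i) (h : ∀ i, Epi (f i))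
    (l : List ι) : Epi (tensMap f l) := by
  induction l with
  | nil => exact inferInstanceAs (Epi (𝟙 _))
  | cons a l ih =>
    have := h a
    exact epi_tensorHom _ _

end TensorPowers

/-! ### Algebras over a family of endofunctors -/

section OpAlg

variable {M : Type u} [Category.{v} M] {κ : Type w}

/-- An object together with an operation `g k X ⟶ X` for each member of a family `g` of
endofunctors. No equations are imposed. -/
structure OpAlg (g : κ → M ⥤ M) where
  carrier : M
  act : ∀ k, (g k).obj carrier ⟶ carrier

namespace OpAlg

variable {g : κ → M ⥤ M}

/-- A morphism compatible with all operations. -/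
@[ext]
structure Hom (A B : OpAlg g) where
  hom : A.carrier ⟶ B.carrier
  act_hom : ∀ k, A.act k ≫ hom = (g k).map hom ≫ B.act k

instance category : Category.{v} (OpAlg g) where
  Hom A B := Hom A B
  id A := ⟨𝟙 _, fun k => by simp⟩
  comp f h := ⟨f.hom ≫ h.hom, fun k => by
    rw [← Category.assoc, f.act_hom, Category.assoc, h.act_hom]; simp⟩

@[ext]
lemma hom_ext {A B : OpAlg g} (f h : A ⟶ B) (e : f.hom = h.hom) : f = h := Hom.ext e

lemma act_hom {A B : OpAlg g} (f : A ⟶ B) (k : κ) :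
    A.act k ≫ f.hom = (g k).map f.hom ≫ B.act k := f.act_hom k

variable (g) in
/-- The underlying object of an `OpAlg`. -/
@[reducible]
def forget : OpAlg g ⥤ M where
  obj A := A.carrier
  map f := f.hom

instance : (forget g).Faithful where
  map_injective h := hom_ext _ _ h

/-! ### Colimits created from the underlying category -/

section Colimits

variable {J : Type*} [Category J] [∀ k, PreservesColimitsOfShape J (g k)] (K : J ⥤ OpAlg g)
  {c : Cocone (K ⋙ forget g)} (hc : IsColimit c)

/-- The operations on a colimit of underlying objects. -/
noncomputable def colimitAct (k : κ) : (g k).obj c.pt ⟶ c.pt :=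
  (isColimitOfPreserves (g k) hc).desc
    { pt := c.pt
      ι :=
        { app := fun i => (K.obj i).act k ≫ c.ι.app i
          naturality := fun i i' f => by
            have h : (g k).map (K.map f).hom ≫ (K.obj i').act k ≫ c.ι.app i' =
                (K.obj i).act k ≫ c.ι.app i := by
              rw [← Category.assoc, ← act_hom, Category.assoc]
              exact congrArg ((K.obj i).act k ≫ ·) (c.w f)
            exact h.trans (Category.comp_id _).symm } }

lemma ι_colimitAct (k : κ) (i : J) :
    (g k).map (c.ι.app i) ≫ colimitAct K hc k = (K.obj i).act k ≫ c.ι.app i :=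
  (isColimitOfPreserves (g k) hc).fac _ i

/-- The cocone in `OpAlg g` over a colimit cocone of underlying objects. -/
@[simps]
noncomputable def colimitCocone : Cocone K where
  pt := ⟨c.pt, colimitAct K hc⟩
  ι :=
    { app := fun i => ⟨c.ι.app i, fun k => (ι_colimitAct K hc k i).symm⟩
      naturality := fun i i' f => by
        ext
        exact c.ι.naturality f }

/-- The cocone `colimitCocone` is a colimit. -/
noncomputable def isColimitColimitCocone : IsColimit (colimitCocone K hc) where
  desc s :=
    { hom := hc.desc ((forget g).mapCocone s)
      act_hom := fun k => (isColimitOfPreserves (g k) hc).hom_ext fun i => by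
        have h' : c.ι.app i ≫ hc.desc ((forget g).mapCocone s) = (s.ι.app i).hom :=
          hc.fac ((forget g).mapCocone s) i
        have h : (g k).map (c.ι.app i) ≫ colimitAct K hc k ≫ hc.desc ((forget g).mapCocone s) =
            (g k).map (c.ι.app i) ≫ (g k).map (hc.desc ((forget g).mapCocone s)) ≫
              s.pt.act k := by
          rw [← Category.assoc, ι_colimitAct, Category.assoc, h', ← Category.assoc,
            ← Functor.map_comp, h']
          exact (s.ι.app i).act_hom k
        exact h }
  fac s i := by
    ext
    exact hc.fac ((forget g).mapCocone s) i
  uniq s m hm := by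
    ext
    exact hc.uniq ((forget g).mapCocone s) m.hom fun i => congrArg Hom.hom (hm i)

instance hasColimitsOfShape [HasColimitsOfShape J M] : HasColimitsOfShape J (OpAlg g) where
  has_colimit K := ⟨⟨_, isColimitColimitCocone K (colimit.isColimit _)⟩⟩

instance preservesColimitsOfShape_forget [HasColimitsOfShape J M] :
    PreservesColimitsOfShape J (forget g) where
  preservesColimit {K} := preservesColimit_of_preserves_colimit_cocone
    (isColimitColimitCocone K (colimit.isColimit _))
    ((colimit.isColimit (K ⋙ forget g)).ofIsoColimit (Cocone.ext (Iso.refl _) fun _ => Category.comp_id _))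

end Colimits

/-! ### Free objects as colimits of a chain of stages -/

section Free

variable [HasColimitsOfShape (Discrete κ) M] [HasInitial M] [HasBinaryCoproducts M]

variable (g) in
/-- The stages of the construction of the free `OpAlg` on `X`. -/
noncomputable def freeStage (X : M) : ℕ → M
  | 0 => ⊥_ M
  | n + 1 => X ⨿ ∐ fun k => (g k).obj (freeStage X n)

variable (g) in
/-- The inclusion of a stage into the next. -/
noncomputable def freeStageMap (X : M) : (n : ℕ) → (freeStage g X n ⟶ freeStage g X (n + 1))
  | 0 => initial.to _
  | n + 1 => coprod.map (𝟙 X) (Limits.Sigma.map fun k => (g k).map (freeStageMap X n))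

variable (g) in
/-- The generators, in a positive stage. -/
noncomputable def freeStageGen (X : M) (n : ℕ) : X ⟶ freeStage g X (n + 1) :=
  coprod.inl

variable (g) in
/-- The operations, raising the stage by one. -/
noncomputable def freeStageAct (X : M) (n : ℕ) (k : κ) :
    (g k).obj (freeStage g X n) ⟶ freeStage g X (n + 1) :=
  Sigma.ι (fun k => (g k).obj (freeStage g X n)) k ≫ coprod.inr

lemma freeStage_hom_ext {X Y : M} {n : ℕ} {a b : freeStage g X (n + 1) ⟶ Y}
    (h : freeStageGen g X n ≫ a = freeStageGen g X n ≫ b)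
    (h' : ∀ k, freeStageAct g X n k ≫ a = freeStageAct g X n k ≫ b) : a = b :=
  coprod.hom_ext h (Limits.Sigma.hom_ext _ _ fun k =>
    (Category.assoc _ _ _).symm.trans ((h' k).trans (Category.assoc _ _ _)))

lemma freeStageGen_map (X : M) (n : ℕ) :
    freeStageGen g X n ≫ freeStageMap g X (n + 1) = freeStageGen g X (n + 1) := by
  exact (coprod.inl_map _ _).trans (Category.id_comp _)

lemma freeStageAct_map (X : M) (n : ℕ) (k : κ) :
    freeStageAct g X n k ≫ freeStageMap g X (n + 1) =
      (g k).map (freeStageMap g X n) ≫ freeStageAct g X (n + 1) k := by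
  have h : (Sigma.ι (fun k => (g k).obj (freeStage g X n)) k ≫ coprod.inr (X := X)) ≫
      coprod.map (𝟙 X) (Limits.Sigma.map fun k => (g k).map (freeStageMap g X n)) =
      (g k).map (freeStageMap g X n) ≫
        Sigma.ι (fun k => (g k).obj (freeStage g X (n + 1))) k ≫ coprod.inr := by
    simp
  exact h

/-- Extension of a morphism `X ⟶ A` to the stages. -/
noncomputable def freeStageDesc {X : M} {A : OpAlg g} (f : X ⟶ A.carrier) :
    (n : ℕ) → (freeStage g X n ⟶ A.carrier)
  | 0 => initial.to _
  | n + 1 => coprod.desc f (Limits.Sigma.desc fun k => (g k).map (freeStageDesc f n) ≫ A.act k)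

lemma freeStageGen_desc {X : M} {A : OpAlg g} (f : X ⟶ A.carrier) (n : ℕ) :
    freeStageGen g X n ≫ freeStageDesc f (n + 1) = f := by
  exact coprod.inl_desc _ _

lemma freeStageAct_desc {X : M} {A : OpAlg g} (f : X ⟶ A.carrier) (n : ℕ) (k : κ) :
    freeStageAct g X n k ≫ freeStageDesc f (n + 1) = (g k).map (freeStageDesc f n) ≫ A.act k := by
  exact (Category.assoc _ _ _).trans
    ((congrArg (Sigma.ι (fun k => (g k).obj (freeStage g X n)) k ≫ ·)
      (coprod.inr_desc _ _)).trans (colimit.ι_desc _ _))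

lemma freeStageMap_desc {X : M} {A : OpAlg g} (f : X ⟶ A.carrier) (n : ℕ) :
    freeStageMap g X n ≫ freeStageDesc f (n + 1) = freeStageDesc f n := by
  induction n with
  | zero => exact initial.hom_ext _ _
  | succ n ih =>
    refine freeStage_hom_ext ?_ fun k => ?_
    · rw [← Category.assoc, freeStageGen_map, freeStageGen_desc, freeStageGen_desc]
    · rw [← Category.assoc, freeStageAct_map, Category.assoc, freeStageAct_desc,
        freeStageAct_desc, ← Category.assoc, ← Functor.map_comp, ih]

variable [HasColimitsOfShape ℕ M]

/-- A cocone over the image under `F` of the sequence of stages. -/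
@[reducible]
noncomputable def stageCocone (X : M) (F : M ⥤ M) {T : M}
    (φ : ∀ n, F.obj (freeStage g X n) ⟶ T)
    (h : ∀ n, F.map (freeStageMap g X n) ≫ φ (n + 1) = φ n) :
    Cocone (Functor.ofSequence (freeStageMap g X) ⋙ F) where
  pt := T
  ι := NatTrans.ofSequence φ fun n =>
    (congrArg (· ≫ φ (n + 1)) (congrArg F.map
      (Functor.ofSequence_map_homOfLE_succ (freeStageMap g X) n))).trans
        ((h n).trans (Category.comp_id _).symm)

variable (g) in
/-- The underlying object of the free `OpAlg` on `X`. -/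
noncomputable def freeCarrier (X : M) : M := colimit (Functor.ofSequence (freeStageMap g X))

variable (g) in
/-- The inclusion of a stage into the free `OpAlg`. -/
noncomputable def freeι (X : M) (n : ℕ) : freeStage g X n ⟶ freeCarrier g X :=
  colimit.ι (Functor.ofSequence (freeStageMap g X)) n

lemma freeStageMap_freeι (X : M) (n : ℕ) :
    freeStageMap g X n ≫ freeι g X (n + 1) = freeι g X n := by
  have h := colimit.w (Functor.ofSequence (freeStageMap g X)) (homOfLE (Nat.le_add_right n 1))
  rwa [Functor.ofSequence_map_homOfLE_succ] at h

/-- The image under a functor preserving sequential colimits of the free `OpAlg` is the colimit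
of the images of the stages. -/
lemma exists_stage_desc (X : M) (F : M ⥤ M) [PreservesColimitsOfShape ℕ F] {T : M}
    (φ : ∀ n, F.obj (freeStage g X n) ⟶ T)
    (h : ∀ n, F.map (freeStageMap g X n) ≫ φ (n + 1) = φ n) :
    ∃ d : F.obj (freeCarrier g X) ⟶ T, ∀ n, F.map (freeι g X n) ≫ d = φ n :=
  ⟨(isColimitOfPreserves F (colimit.isColimit (Functor.ofSequence (freeStageMap g X)))).desc
    (stageCocone X F φ h), fun n => (isColimitOfPreserves F
      (colimit.isColimit (Functor.ofSequence (freeStageMap g X)))).fac (stageCocone X F φ h) n⟩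

lemma stage_hom_ext (X : M) (F : M ⥤ M) [PreservesColimitsOfShape ℕ F] {T : M}
    {a b : F.obj (freeCarrier g X) ⟶ T}
    (h : ∀ n, F.map (freeι g X n) ≫ a = F.map (freeι g X n) ≫ b) : a = b :=
  (isColimitOfPreserves F (colimit.isColimit (Functor.ofSequence (freeStageMap g X)))).hom_ext h

variable (g) in
/-- The inclusion of the generators. -/
noncomputable def freeUnit (X : M) : X ⟶ freeCarrier g X := freeStageGen g X 0 ≫ freeι g X 1

lemma freeStageGen_freeι (X : M) (n : ℕ) :
    freeStageGen g X n ≫ freeι g X (n + 1) = freeUnit g X := by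
  induction n with
  | zero => rfl
  | succ n ih => rw [← freeStageGen_map, Category.assoc, freeStageMap_freeι, ih]

variable [∀ k, PreservesColimitsOfShape ℕ (g k)]

/-- This is Adámek's construction of the initial algebra of `Y ↦ X ⨿ ∐ k, g k Y`: since `g k`
preserves the colimit of the chain, the operations that raise the stage by one glue to an operation
on the colimit. -/
lemma exists_freeAct (X : M) (k : κ) :
    ∃ d : (g k).obj (freeCarrier g X) ⟶ freeCarrier g X,
      ∀ n, (g k).map (freeι g X n) ≫ d = freeStageAct g X n k ≫ freeι g X (n + 1) :=
  exists_stage_desc X (g k) (fun n => freeStageAct g X n k ≫ freeι g X (n + 1)) fun n => by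
    rw [← Category.assoc, ← freeStageAct_map, Category.assoc, freeStageMap_freeι]

variable (g) in
/-- The free `OpAlg` on `X`. -/
@[reducible]
noncomputable def free (X : M) : OpAlg g where
  carrier := freeCarrier g X
  act k := (exists_freeAct X k).choose

lemma freeι_act (X : M) (n : ℕ) (k : κ) :
    (g k).map (freeι g X n) ≫ (free g X).act k = freeStageAct g X n k ≫ freeι g X (n + 1) :=
  (exists_freeAct X k).choose_spec n

lemma exists_freeDesc {X : M} {A : OpAlg g} (f : X ⟶ A.carrier) :
    ∃ d : free g X ⟶ A, freeUnit g X ≫ d.hom = f := by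
  obtain ⟨d, hd⟩ := exists_stage_desc X (𝟭 M) (freeStageDesc f) (freeStageMap_desc f)
  have hd' : ∀ n, freeι g X n ≫ d = freeStageDesc f n := hd
  refine ⟨⟨d, fun k => stage_hom_ext X (g k) fun n => ?_⟩, ?_⟩
  · rw [← Category.assoc, freeι_act, Category.assoc, hd', ← Category.assoc, ← Functor.map_comp,
      hd', freeStageAct_desc]
  · exact (Category.assoc _ _ _).trans ((congrArg _ (hd' 1)).trans (freeStageGen_desc f 0))

lemma free_hom_ext {X : M} {A : OpAlg g} {a b : free g X ⟶ A}
    (h : freeUnit g X ≫ a.hom = freeUnit g X ≫ b.hom) : a = b := by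
  ext
  refine stage_hom_ext X (𝟭 M) fun n => ?_
  change freeι g X n ≫ _ = freeι g X n ≫ _
  induction n with
  | zero => exact initial.hom_ext _ _
  | succ n ih =>
    refine freeStage_hom_ext ?_ fun k => ?_
    · rw [← Category.assoc, ← Category.assoc, freeStageGen_freeι, h]
    · rw [← Category.assoc, ← Category.assoc, ← freeι_act, Category.assoc, Category.assoc,
        act_hom, act_hom, ← Category.assoc, ← Functor.map_comp, ih, Functor.map_comp,
        Category.assoc]

instance isRightAdjoint_forget : (forget g).IsRightAdjoint := by
  rw [isRightAdjoint_iff_hasInitial_structuredArrow]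
  intro X
  refine IsInitial.hasInitial (X := StructuredArrow.mk (Y := free g X) (freeUnit g X)) ?_
  refine IsInitial.ofUniqueHom
    (fun A => StructuredArrow.homMk (exists_freeDesc A.hom).choose
      (exists_freeDesc A.hom).choose_spec) fun A m => ?_
  refine StructuredArrow.hom_ext _ _ (free_hom_ext ?_)
  exact (StructuredArrow.w m).trans (exists_freeDesc A.hom).choose_spec.symm

end Free

end OpAlg

end OpAlg

/-! ### Presentations of diagrams of algebras by generators and relations -/

section Presentations

/-- A parallel pair of morphisms into the underlying object of a free object can be replaced by a
reflexive pair into the free object. -/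
lemma exists_reflexivePair_of_adjunction {V : Type*} {N : Type*} [Category V] [Category N]
    [HasBinaryCoproducts N] {L : N ⥤ V} {U : V ⥤ N} (adj : L ⊣ U) {G R : N}
    (a b : R ⟶ U.obj (L.obj G)) :
    ∃ (X : V) (a' b' : X ⟶ L.obj G), IsReflexivePair a' b' ∧ ∀ {B : V} (h : L.obj G ⟶ B),
      a' ≫ h = b' ≫ h ↔ a ≫ U.map h = b ≫ U.map h := by
  -- Adjoining a copy of `G` to the relations, sent to the generators by the unit, adds no new
  -- relation but provides the common section `L.map coprod.inl`.
  let t : (R ⟶ U.obj (L.obj G)) → (L.obj (G ⨿ R) ⟶ L.obj G) := fun c =>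
    (adj.homEquiv _ _).symm (coprod.desc (adj.unit.app G) c)
  have ht : ∀ c, L.map coprod.inl ≫ t c = 𝟙 _ := fun c => by
    rw [← Adjunction.homEquiv_naturality_left_symm, coprod.inl_desc]
    simp [Adjunction.homEquiv_counit]
  refine ⟨L.obj (G ⨿ R), t a, t b, ⟨L.map coprod.inl, ht a, ht b⟩, fun {B} h => ?_⟩
  rw [← Adjunction.homEquiv_naturality_right_symm, ← Adjunction.homEquiv_naturality_right_symm,
    Equiv.apply_eq_iff_eq]
  refine ⟨fun e => ?_, fun e => ?_⟩
  · have e' := congrArg (coprod.inr ≫ ·) e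
    simp only [← Category.assoc, coprod.inr_desc] at e'
    exact e'
  · apply coprod.hom_ext
    · rw [← Category.assoc, ← Category.assoc, coprod.inl_desc, coprod.inl_desc]
    · rw [← Category.assoc, ← Category.assoc, coprod.inr_desc, coprod.inr_desc, e]

/-- Coequalizers of reflexive pairs are mapped to epimorphisms by functors that preserve them. -/
lemma exists_coequalizer_of_isReflexivePair {V : Type*} [Category V]
    [HasReflexiveCoequalizers V] {X Y : V} (a b : X ⟶ Y) [IsReflexivePair a b] :
    ∃ (B : V) (q : Y ⟶ B), a ≫ q = b ≫ q ∧
      (∀ {B' : V} (f : Y ⟶ B'), a ≫ f = b ≫ f → ∃! h : B ⟶ B', q ≫ h = f) ∧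
      ∀ {N : Type u} [Category.{v} N] (E : V ⥤ N)
        [PreservesColimitsOfShape WalkingReflexivePair E], Epi (E.map q) := by
  refine ⟨coequalizer a b, coequalizer.π a b, coequalizer.condition _ _, fun f hf =>
    ⟨coequalizer.desc f hf, coequalizer.π_desc _ _, fun h hh => ?_⟩, fun {N} _ E _ => ?_⟩
  · apply coequalizer.hom_ext
    rw [coequalizer.π_desc]
    exact hh
  -- In a colimit cocone over the reflexive pair, the leg at `one` factors through the leg at
  -- `zero`, so the latter alone is jointly epimorphic; `E` preserves the cocone.
  · have h : Epi (E.map (colimit.ι (ofIsReflexivePair a b) WalkingReflexivePair.zero)) := by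
      refine ⟨fun x y hxy => (isColimitOfPreserves E
        (colimit.isColimit (ofIsReflexivePair a b))).hom_ext ?_⟩
      rintro (_ | _)
      · exact hxy
      · rw [← (E.mapCocone (colimit.cocone (ofIsReflexivePair a b))).w
          WalkingReflexivePair.Hom.left, Category.assoc, Category.assoc]
        exact congrArg _ hxy
    have e := congrArg E.map (ι_colimitOfIsReflexivePairIsoCoequalizer_hom (f := a) (g := b))
    rw [Functor.map_comp] at e
    have h' : Epi (E.map (colimit.ι (ofIsReflexivePair a b) WalkingReflexivePair.zero) ≫
      E.map colimitOfIsReflexivePairIsoCoequalizer.hom) := epi_comp _ _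
    rwa [e] at h'

variable {M : Type u} [Category.{v} M] [HasColimits M]

/-- A family of parallel pairs into values of a functor can be replaced by a single parallel pair
of natural transformations. -/
lemma exists_relations {D : Type v} [SmallCategory D] {K : D ⥤ M} {I : Type v} (d : I → D)
    (Z : I → M) (a b : ∀ i, Z i ⟶ K.obj (d i)) :
    ∃ (R : D ⥤ M) (a' b' : R ⟶ K), ∀ {K' : D ⥤ M} (h : K ⟶ K'), a' ≫ h = b' ≫ h ↔
      ∀ i, a i ≫ h.app (d i) = b i ≫ h.app (d i) := by
  -- Evaluation at `d i` has a left adjoint, so each pair at a single object becomes a pair of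
  -- natural transformations; their coproduct collects them all.
  let adj := fun i => evaluationAdjunctionRight M (d i)
  refine ⟨∐ fun i => (evaluationLeftAdjoint M (d i)).obj (Z i),
    Limits.Sigma.desc fun i => ((adj i).homEquiv _ _).symm (a i),
    Limits.Sigma.desc fun i => ((adj i).homEquiv _ _).symm (b i), fun {K'} h => ?_⟩
  have key : ∀ i, ((adj i).homEquiv (Z i) K).symm (a i) ≫ h = ((adj i).homEquiv _ _).symm (b i) ≫ h ↔
      a i ≫ h.app (d i) = b i ≫ h.app (d i) := fun i => by
    rw [← Adjunction.homEquiv_naturality_right_symm, ← Adjunction.homEquiv_naturality_right_symm,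
      Equiv.apply_eq_iff_eq]
    rfl
  refine ⟨fun e i => (key i).1 ?_, fun e => Limits.Sigma.hom_ext _ _ fun i => ?_⟩
  · simpa using congrArg (Limits.Sigma.ι _ i ≫ ·) e
  · simpa using (key i).2 (e i)

variable {κ : Type w} {g : κ → M ⥤ M} {D : Type v} [SmallCategory D]

/-- A natural equation between two derived operations on diagrams of `OpAlg`s, whose arity
preserves epimorphisms. -/
structure Law (D : Type v) [SmallCategory D] (g : κ → M ⥤ M) where
  /-- the index at which the equation takes place -/
  idx : D
  /-- the arity -/
  src : (D ⥤ OpAlg g) → M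
  map : ∀ {A B : D ⥤ OpAlg g}, (A ⟶ B) → (src A ⟶ src B)
  lhs : ∀ A, src A ⟶ (A.obj idx).carrier
  rhs : ∀ A, src A ⟶ (A.obj idx).carrier
  map_lhs : ∀ {A B : D ⥤ OpAlg g} (f : A ⟶ B), map f ≫ lhs B = lhs A ≫ (f.app idx).hom
  map_rhs : ∀ {A B : D ⥤ OpAlg g} (f : A ⟶ B), map f ≫ rhs B = rhs A ≫ (f.app idx).hom
  epi_map : ∀ {A B : D ⥤ OpAlg g} (f : A ⟶ B), (∀ d, Epi (f.app d).hom) → Epi (map f)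

variable [HasColimitsOfShape (Discrete κ) M] [∀ k, PreservesColimitsOfShape ℕ (g k)]

variable (g) in
/-- The diagram of free `OpAlg`s on a diagram of objects. -/
noncomputable abbrev freeDiagram (G : D ⥤ M) : D ⥤ OpAlg g :=
  ((Functor.whiskeringRight D M (OpAlg g)).obj (OpAlg.forget g).leftAdjoint).obj G

variable (g) in
/-- The inclusion of the generators. -/
noncomputable def freeDiagramUnit (G : D ⥤ M) : G ⟶ freeDiagram g G ⋙ OpAlg.forget g :=
  ((Adjunction.ofIsRightAdjoint (OpAlg.forget g)).whiskerRight D).unit.app G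

lemma existsUnique_freeDiagramDesc {G : D ⥤ M} {A : D ⥤ OpAlg g} (f : G ⟶ A ⋙ OpAlg.forget g) :
    ∃! h : freeDiagram g G ⟶ A,
      freeDiagramUnit g G ≫ Functor.whiskerRight h (OpAlg.forget g) = f := by
  let e := ((Adjunction.ofIsRightAdjoint (OpAlg.forget g)).whiskerRight D).homEquiv G A
  have he : ∀ h : freeDiagram g G ⟶ A,
      freeDiagramUnit g G ≫ Functor.whiskerRight h (OpAlg.forget g) = e h := fun h =>
    (Adjunction.homEquiv_unit _ _ _ _).symm
  exact ⟨e.symm f, (he _).trans (e.apply_symm_apply f), fun h hh => by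
    rw [Equiv.eq_symm_apply, ← he, hh]⟩

/-- The free diagram is formed objectwise, so its value at `d` is itself free on `G.obj d`. Here `A`
is a single object, not a diagram. -/
lemma freeDiagram_obj_hom_ext {G : D ⥤ M} {d : D} {A : OpAlg g}
    {a b : (freeDiagram g G).obj d ⟶ A}
    (h : (freeDiagramUnit g G).app d ≫ a.hom = (freeDiagramUnit g G).app d ≫ b.hom) : a = b := by
  let adj := Adjunction.ofIsRightAdjoint (OpAlg.forget g)
  have hu : (freeDiagramUnit g G).app d = adj.unit.app (G.obj d) := by
    refine ((Adjunction.whiskerRight_unit_app_app D adj G d)).trans ?_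
    simp
  apply (adj.homEquiv _ _).injective
  refine (Adjunction.homEquiv_unit _ _ _ _).trans (Eq.trans ?_
    (Adjunction.homEquiv_unit _ _ _ _).symm)
  rw [← hu]
  exact h

variable [∀ k, PreservesColimitsOfShape WalkingReflexivePair (g k)]

/-- Quotients of diagrams of free `OpAlg`s by families of relations. -/
lemma exists_quotient (G : D ⥤ M) {I : Type v} (d : I → D) (Z : I → M)
    (a b : ∀ i, Z i ⟶ ((freeDiagram g G).obj (d i)).carrier) :
    ∃ (B : D ⥤ OpAlg g) (q : freeDiagram g G ⟶ B),
      (∀ i, a i ≫ (q.app (d i)).hom = b i ≫ (q.app (d i)).hom) ∧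
      (∀ {B' : D ⥤ OpAlg g} (f : freeDiagram g G ⟶ B'),
        (∀ i, a i ≫ (f.app (d i)).hom = b i ≫ (f.app (d i)).hom) → ∃! h : B ⟶ B', q ≫ h = f) ∧
      ∀ c, Epi (q.app c).hom := by
  obtain ⟨R, a', b', hR⟩ := exists_relations (K := freeDiagram g G ⋙ OpAlg.forget g) d Z a b
  obtain ⟨X, a'', b'', hX, hX'⟩ := exists_reflexivePair_of_adjunction
    ((Adjunction.ofIsRightAdjoint (OpAlg.forget g)).whiskerRight D) (G := G) a' b'
  have key : ∀ {B' : D ⥤ OpAlg g} (f : freeDiagram g G ⟶ B'), a'' ≫ f = b'' ≫ f ↔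
      ∀ i, a i ≫ (f.app (d i)).hom = b i ≫ (f.app (d i)).hom := fun f =>
    (hX' f).trans (hR (Functor.whiskerRight f (OpAlg.forget g)))
  have : HasReflexiveCoequalizers (D ⥤ OpAlg g) := hasReflexiveCoequalizers_iff.1 inferInstance
  obtain ⟨B, q, hq, hB, hE⟩ := exists_coequalizer_of_isReflexivePair.{v, u} a'' b''
  -- Evaluation at `c` followed by the forgetful functor preserves reflexive coequalizers, so `q` is
  -- an epimorphism in `M` at each object.
  exact ⟨B, q, (key q).1 hq, fun f hf => hB f ((key f).2 hf), fun c =>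
    hE ((evaluation D (OpAlg g)).obj c ⋙ OpAlg.forget g)⟩

/-- Quotients of diagrams of free `OpAlg`s by families of laws and relations. -/
theorem exists_model {I : Type v} (law : I → Law D g) (G : D ⥤ M) {I' : Type v} (d : I' → D)
    (Z : I' → M) (a b : ∀ i, Z i ⟶ ((freeDiagram g G).obj (d i)).carrier) :
    ∃ (B : D ⥤ OpAlg g) (q : freeDiagram g G ⟶ B), (∀ i, (law i).lhs B = (law i).rhs B) ∧
      (∀ i, a i ≫ (q.app (d i)).hom = b i ≫ (q.app (d i)).hom) ∧
      (∀ {B' : D ⥤ OpAlg g} (f : freeDiagram g G ⟶ B'), (∀ i, (law i).lhs B' = (law i).rhs B') →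
        (∀ i, a i ≫ (f.app (d i)).hom = b i ≫ (f.app (d i)).hom) → ∃! h : B ⟶ B', q ≫ h = f) ∧
      ∀ c, Epi (q.app c).hom := by
  -- Each law is imposed only on the free diagram, as one more relation.
  obtain ⟨B, q, hq, hB, hepi⟩ := exists_quotient (g := g) G (I := I ⊕ I')
    (Sum.elim (fun i => (law i).idx) d) (Sum.elim (fun i => (law i).src (freeDiagram g G)) Z)
    (fun i => match i with
      | Sum.inl i => (law i).lhs _
      | Sum.inr i => a i)
    (fun i => match i with
      | Sum.inl i => (law i).rhs _
      | Sum.inr i => b i)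
  refine ⟨B, q, fun i => ?_, fun i => hq (Sum.inr i), fun f hf hf' => hB f ?_, hepi⟩
  -- The law passes to the quotient: both of its sides agree after precomposition with the arity of
  -- `q`, which is an epimorphism.
  · have := (law i).epi_map q hepi
    rw [← cancel_epi ((law i).map q), (law i).map_lhs, (law i).map_rhs]
    exact hq (Sum.inl i)
  · rintro (i | i)
    -- Conversely, by naturality of both sides, any morphism to a model of the law respects the
    -- relation.
    · change (law i).lhs _ ≫ (f.app (law i).idx).hom = (law i).rhs _ ≫ (f.app (law i).idx).hom
      rw [← (law i).map_lhs, ← (law i).map_rhs, hf i]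
    · exact hf' i

end Presentations

/-! ### Naturality of the canonical morphisms between tensor products -/

section Naturality

variable {M : Type u} [Category.{v} M] [MonoidalCategory M]

lemma tensorHom_whiskerLeft_comm {X Y A B A' B' : M} (f : X ⟶ Y) {p : A ⟶ B} {q : B ⟶ B'}
    {q' : A ⟶ A'} {p' : A' ⟶ B'} (h : p ≫ q = q' ≫ p') :
    (f ⊗ₘ p) ≫ Y ◁ q = X ◁ q' ≫ (f ⊗ₘ p') := by
  rw [← MonoidalCategory.id_tensorHom, ← MonoidalCategory.id_tensorHom,
    MonoidalCategory.tensorHom_comp_tensorHom, MonoidalCategory.tensorHom_comp_tensorHom, h,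
    Category.comp_id, Category.id_comp]

lemma tensorHom_whiskerLeft_map_comm {A B X X' Y Y' : M} (r : A ⟶ B) {f : X ⟶ Y} {u : Y ⟶ Y'}
    {u' : X ⟶ X'} {f' : X' ⟶ Y'} (h : f ≫ u = u' ≫ f') {Z : M} (a : B ⊗ Y' ⟶ Z) :
    A ◁ f ≫ (r ⊗ₘ u) ≫ a = (r ⊗ₘ u') ≫ B ◁ f' ≫ a := by
  rw [← MonoidalCategory.id_tensorHom, ← MonoidalCategory.id_tensorHom,
    MonoidalCategory.tensorHom_comp_tensorHom_assoc,
    MonoidalCategory.tensorHom_comp_tensorHom_assoc, h, Category.comp_id, Category.id_comp]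

lemma tensOne_natural {X Y : M} (f : X ⟶ Y) :
    f ≫ tensOne Y = tensOne X ≫ tensMap (fun _ => f) (List.finRange 1) :=
  (MonoidalCategory.rightUnitor_inv_naturality f).trans
    (congrArg ((ρ_ X).inv ≫ ·) (MonoidalCategory.tensorHom_id f (𝟙_ M)).symm)

lemma tensTwo_natural {X Y : M} (f : X ⟶ Y) :
    (f ⊗ₘ f) ≫ tensTwo Y = tensTwo X ≫ tensMap (fun _ => f) (List.finRange 2) :=
  tensorHom_whiskerLeft_comm f (tensOne_natural f)

lemma tensorHom_tensorHom_comm {A B A' B' C D C' D' E E' : M} {p₁ : A ⟶ B} {q₁ : B ⟶ B'}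
    {q₁' : A ⟶ A'} {p₁' : A' ⟶ B'} {p₂ : C ⟶ D} {q₂ : D ⟶ D'} {q₂' : C ⟶ C'} {p₂' : C' ⟶ D'}
    {s : B' ⊗ D' ⟶ E} {s' : A' ⊗ C' ⟶ E'} {t : E' ⟶ E}
    (h₁ : p₁ ≫ q₁ = q₁' ≫ p₁') (h₂ : p₂ ≫ q₂ = q₂' ≫ p₂') (h : (p₁' ⊗ₘ p₂') ≫ s = s' ≫ t) :
    (p₁ ⊗ₘ p₂) ≫ (q₁ ⊗ₘ q₂) ≫ s = ((q₁' ⊗ₘ q₂') ≫ s') ≫ t := by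
  rw [MonoidalCategory.tensorHom_comp_tensorHom_assoc, h₁, h₂,
    ← MonoidalCategory.tensorHom_comp_tensorHom_assoc, h, Category.assoc]

lemma tensAppend_natural {ι : Type} {X Y : ι → M} (f : ∀ i, X i ⟶ Y i) (l l' : List ι) :
    (tensMap f l ⊗ₘ tensMap f l') ≫ tensAppend Y l l' =
      tensAppend X l l' ≫ tensMap f (l ++ l') := by
  induction l with
  | nil => simp [tensAppend, tensMap]
  | cons a l ih =>
    simp only [tensAppend, tensMap, List.cons_append, Category.assoc]
    rw [MonoidalCategory.associator_naturality_assoc, tensorHom_whiskerLeft_comm _ ih]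

lemma tensToMap_natural {ι κ : Type} {X Y : ι → M} (f : ∀ i, X i ⟶ Y i) (e : κ → ι)
    (l : List κ) :
    tensMap (fun k => f (e k)) l ≫ tensToMap Y e l = tensToMap X e l ≫ tensMap f (l.map e) := by
  induction l with
  | nil => rfl
  | cons a l ih => exact tensorHom_whiskerLeft_comm _ ih

lemma tensFromMap_natural {ι κ : Type} {X Y : ι → M} (f : ∀ i, X i ⟶ Y i) (e : κ → ι)
    (l : List κ) :
    tensMap f (l.map e) ≫ tensFromMap Y e l =
      tensFromMap X e l ≫ tensMap (fun k => f (e k)) l := by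
  induction l with
  | nil => rfl
  | cons a l ih => exact tensorHom_whiskerLeft_comm _ ih

lemma tensSigma_natural {ι : Type} {κ : ι → Type} {X Y : ∀ i, κ i → M}
    (f : ∀ i j, X i j ⟶ Y i j) (K : ∀ i, List (κ i)) (l : List ι) :
    tensMap (fun i => tensMap (f i) (K i)) l ≫ tensSigma Y K l =
      tensSigma X K l ≫ tensMap (fun p : (i : ι) × κ i => f p.1 p.2) (l.sigma K) := by
  induction l with
  | nil => rfl
  | cons a l ih =>
    exact tensorHom_tensorHom_comm
      (tensToMap_natural (fun p : (i : ι) × κ i => f p.1 p.2) (Sigma.mk a) (K a)) ih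
      (tensAppend_natural (fun p : (i : ι) × κ i => f p.1 p.2) ((K a).map (Sigma.mk a))
        (l.sigma K))

lemma tensMap_eqToHom {ι : Type} {X Y : ι → M} (f : ∀ i, X i ⟶ Y i) {l l' : List ι}
    (h : l = l') :
    tensMap f l ≫ eqToHom (congrArg (tens Y) h) = eqToHom (congrArg (tens X) h) ≫ tensMap f l' := by
  subst h
  simp

variable [SymmetricCategory M]

lemma tensPull_natural {ι : Type} [DecidableEq ι] {X Y : ι → M} (f : ∀ i, X i ⟶ Y i) (a : ι)
    (l : List ι) (h : a ∈ l) :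
    tensMap f l ≫ tensPull Y a l h = tensPull X a l h ≫ (f a ⊗ₘ tensMap f (l.erase a)) := by
  induction l with
  | nil => exact absurd h List.not_mem_nil
  | cons b l ih =>
    by_cases hb : b = a
    · subst hb
      have e : (b :: l) = b :: (b :: l).erase b := by rw [List.erase_cons_head]
      simp only [tensPull, dif_pos]
      exact tensMap_eqToHom f e
    · have e : b :: l.erase a = (b :: l).erase a := by
        rw [List.erase_cons_tail (by simpa using hb)]
      have h₁ := ih ((List.mem_cons.1 h).resolve_left (Ne.symm hb))
      have h₂ := tensorHom_whiskerLeft_comm (f a) (tensMap_eqToHom f e)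
      have h₃ : ((f b ⊗ₘ f a) ⊗ₘ tensMap f (l.erase a)) ≫
          (β_ (Y b) (Y a)).hom ▷ tens Y (l.erase a) =
          (β_ (X b) (X a)).hom ▷ tens X (l.erase a) ≫
            ((f a ⊗ₘ f b) ⊗ₘ tensMap f (l.erase a)) := by
        rw [← MonoidalCategory.tensorHom_id, ← MonoidalCategory.tensorHom_id,
          MonoidalCategory.tensorHom_comp_tensorHom, MonoidalCategory.tensorHom_comp_tensorHom,
          BraidedCategory.braiding_naturality, Category.comp_id, Category.id_comp]
      simp only [tensPull, dif_neg hb, Category.assoc]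
      rw [tensMap, reassoc_of% tensorHom_whiskerLeft_comm (f b) h₁,
        MonoidalCategory.associator_inv_naturality_assoc, reassoc_of% h₃,
        MonoidalCategory.associator_naturality_assoc]
      exact congrArg (fun t => _ ≫ _ ≫ _ ≫ _ ≫ t) h₂

lemma tensPerm_natural {ι : Type} [DecidableEq ι] {X Y : ι → M} (f : ∀ i, X i ⟶ Y i)
    (l l' : List ι) (h : l.Perm l') :
    tensMap f l ≫ tensPerm Y l l' h = tensPerm X l l' h ≫ tensMap f l' := by
  induction l' generalizing l with
  | nil => exact tensMap_eqToHom f h.eq_nil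
  | cons a l' ih =>
    have h₁ := tensPull_natural f a l (h.mem_iff.2 List.mem_cons_self)
    have h₂ := ih (l.erase a) (List.cons_perm_iff_perm_erase.1 h.symm).2.symm
    simp only [tensPerm, tensMap, Category.assoc]
    rw [reassoc_of% h₁, tensorHom_whiskerLeft_comm _ h₂]

lemma finTensPerm_natural {n : ℕ} (σ : Equiv.Perm (Fin n)) {X Y : Fin n → M}
    (f : ∀ i, X i ⟶ Y i) :
    tensMap f (List.finRange n) ≫ finTensPerm σ Y =
      finTensPerm σ X ≫ tensMap (fun i => f (σ i)) (List.finRange n) := by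
  simp only [finTensPerm, Category.assoc]
  rw [← tensFromMap_natural, ← Category.assoc, tensPerm_natural, Category.assoc]

lemma finTensFlatten_natural {n : ℕ} {k : Fin n → ℕ} {X Y : ∀ i, Fin (k i) → M}
    (f : ∀ i j, X i j ⟶ Y i j) :
    tensMap (fun i => tensMap (f i) (List.finRange (k i))) (List.finRange n) ≫ finTensFlatten Y =
      finTensFlatten X ≫ tensMap (fun a : Fin (∑ i, k i) =>
        f (finSigmaFinEquiv.symm a).1 (finSigmaFinEquiv.symm a).2) (List.finRange _) := by
  have h₁ := tensSigma_natural f (fun i => List.finRange (k i)) (List.finRange n)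
  simp only [finTensFlatten, Category.assoc]
  rw [reassoc_of% h₁, ← tensFromMap_natural (fun p : (i : Fin n) × Fin (k i) => f p.1 p.2),
    ← Category.assoc (tensMap _ _), tensPerm_natural, Category.assoc]

end Naturality

/-! ### Field theories as diagrams subject to laws -/

section Laws

variable {M : Type u} [Category.{v} M] [MonoidalCategory M] [SymmetricCategory M]

/-- The functor `X ↦ P(n) ⊗ X^{⊗ n}`. -/
@[reducible]
def opFunctor (P : Operad M) (n : ℕ) : M ⥤ M where
  obj X := P.ob n ⊗ tensPow n X
  map f := P.ob n ◁ tensMap (fun _ => f) (List.finRange n)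
  map_id X := by rw [tensMap_id, MonoidalCategory.whiskerLeft_id]
  map_comp f f' := by rw [tensMap_comp, MonoidalCategory.whiskerLeft_comp]

instance preservesColimitsOfShape_opFunctor [MonoidalClosed M] (P : Operad M) (n : ℕ)
    {J : Type*} [Category J] [IsSifted J] : PreservesColimitsOfShape J (opFunctor P n) :=
  preservesColimitsOfShape_of_natIso (F := tensFunctor (List.finRange n) ⋙ tensorLeft (P.ob n))
    (NatIso.ofComponents (fun _ => Iso.refl _)
      (fun _ => (Category.comp_id _).trans (Category.id_comp _).symm))

/-- The operations of an algebra over an operad. -/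
@[reducible]
def toOpAlg (P : Operad M) : Alg P ⥤ OpAlg (opFunctor P) where
  obj A := ⟨A.carrier, A.act⟩
  map f := ⟨f.hom, f.act_hom⟩

section AssocNaturality

variable (P : Operad M) {A B : OpAlg (opFunctor P)} (f : A ⟶ B)

lemma assoc_lhs_natural {n : ℕ} (k : Fin n → ℕ) :
    P.ob n ◁ tensMap (fun i => P.ob (k i) ◁ tensMap (fun _ => f.hom) (List.finRange (k i)))
        (List.finRange n) ≫
        P.ob n ◁ tensMap (fun i => B.act (k i)) (List.finRange n) ≫ B.act n =
      (P.ob n ◁ tensMap (fun i => A.act (k i)) (List.finRange n) ≫ A.act n) ≫ f.hom := by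
  rw [Category.assoc, f.act_hom, ← MonoidalCategory.whiskerLeft_comp_assoc,
    ← MonoidalCategory.whiskerLeft_comp_assoc, ← tensMap_comp, ← tensMap_comp]
  simp only [f.act_hom]

lemma assoc_rhs_natural {n : ℕ} (k : Fin n → ℕ) :
    P.ob n ◁ tensMap (fun i => P.ob (k i) ◁ tensMap (fun _ => f.hom) (List.finRange (k i)))
        (List.finRange n) ≫
        P.ob n ◁ finTensZip (fun i => P.ob (k i)) (fun i => tensPow (k i) B.carrier) ≫
        (α_ _ _ _).inv ≫
        (P.comp k ⊗ₘ finTensFlatten (fun (i : Fin n) (_ : Fin (k i)) => B.carrier)) ≫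
        B.act (∑ i, k i) =
      (P.ob n ◁ finTensZip (fun i => P.ob (k i)) (fun i => tensPow (k i) A.carrier) ≫
        (α_ _ _ _).inv ≫
        (P.comp k ⊗ₘ finTensFlatten (fun (i : Fin n) (_ : Fin (k i)) => A.carrier)) ≫
        A.act (∑ i, k i)) ≫ f.hom := by
  have h₁ := tensZip_natural (fun i => 𝟙 (P.ob (k i)))
    (fun i => tensMap (fun _ => f.hom) (List.finRange (k i))) (List.finRange n)
  rw [tensMap_id] at h₁
  simp only [MonoidalCategory.id_tensorHom] at h₁
  have h₂ := finTensFlatten_natural (k := k) (fun _ _ => f.hom)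
  simp only [Category.assoc]
  rw [f.act_hom, ← MonoidalCategory.whiskerLeft_comp_assoc, h₁,
    MonoidalCategory.whiskerLeft_comp_assoc, MonoidalCategory.associator_inv_naturality_right_assoc,
    tensorHom_whiskerLeft_map_comm (P.comp k) h₂]

end AssocNaturality

lemma unit_lhs_natural (P : Operad M) {A B : OpAlg (opFunctor P)} (f : A ⟶ B) :
    f.hom ≫ (λ_ B.carrier).inv ≫ (P.unit ⊗ₘ tensOne B.carrier) ≫ B.act 1 =
      ((λ_ A.carrier).inv ≫ (P.unit ⊗ₘ tensOne A.carrier) ≫ A.act 1) ≫ f.hom := by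
  simp only [Category.assoc]
  rw [f.act_hom, MonoidalCategory.leftUnitor_inv_naturality_assoc,
    tensorHom_whiskerLeft_map_comm P.unit (tensOne_natural f.hom)]

lemma equivariance_lhs_natural (P : Operad M) {A B : OpAlg (opFunctor P)} (f : A ⟶ B) {n : ℕ}
    (σ : Equiv.Perm (Fin n)) :
    P.ob n ◁ tensMap (fun _ => f.hom) (List.finRange n) ≫
        (P.perm σ ⊗ₘ finTensPerm σ (fun _ => B.carrier)) ≫ B.act n =
      ((P.perm σ ⊗ₘ finTensPerm σ (fun _ => A.carrier)) ≫ A.act n) ≫ f.hom := by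
  simp only [Category.assoc]
  rw [f.act_hom, tensorHom_whiskerLeft_map_comm (P.perm σ)
    (finTensPerm_natural σ (fun _ => f.hom))]

variable {D : Type v} [SmallCategory D]

lemma perp_natural (P : Operad M) {A B : D ⥤ OpAlg (opFunctor P)} (f : A ⟶ B)
    (r : 𝟙_ M ⟶ P.ob 2) {d₁ d₂ d : D} (f₁ : d₁ ⟶ d) (f₂ : d₂ ⟶ d) :
    𝟙_ M ◁ ((f.app d₁).hom ⊗ₘ (f.app d₂).hom) ≫
        (r ⊗ₘ (((B.map f₁).hom ⊗ₘ (B.map f₂).hom) ≫ tensTwo (B.obj d).carrier)) ≫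
          (B.obj d).act 2 =
      ((r ⊗ₘ (((A.map f₁).hom ⊗ₘ (A.map f₂).hom) ≫ tensTwo (A.obj d).carrier)) ≫
          (A.obj d).act 2) ≫ (f.app d).hom := by
  have h : ∀ {d' : D} (f' : d' ⟶ d), (f.app d').hom ≫ (B.map f').hom =
      (A.map f').hom ≫ (f.app d).hom := fun f' =>
    (congrArg OpAlg.Hom.hom (f.naturality f')).symm
  have h' : ((f.app d₁).hom ⊗ₘ (f.app d₂).hom) ≫
      ((B.map f₁).hom ⊗ₘ (B.map f₂).hom) ≫ tensTwo (B.obj d).carrier =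
      (((A.map f₁).hom ⊗ₘ (A.map f₂).hom) ≫ tensTwo (A.obj d).carrier) ≫
        tensMap (fun _ => (f.app d).hom) (List.finRange 2) := by
    rw [Category.assoc, ← tensTwo_natural, MonoidalCategory.tensorHom_comp_tensorHom_assoc, h, h,
      ← MonoidalCategory.tensorHom_comp_tensorHom_assoc]
  simp only [Category.assoc]
  rw [(f.app d).act_hom]
  exact tensorHom_whiskerLeft_map_comm r h' _

variable [MonoidalClosed M]

lemma epi_whiskerLeft_tensMap (X : M) {ι : Type} {Y Z : ι → M} (f : ∀ i, Y i ⟶ Z i)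
    (h : ∀ i, Epi (f i)) (l : List ι) : Epi (X ◁ tensMap f l) := by
  have := epi_tensMap f h l
  exact inferInstanceAs (Epi ((tensorLeft X).map (tensMap f l)))

/-- The associativity axiom for algebras over an operad. -/
def assocLaw (P : Operad M) (d : D) {n : ℕ} (k : Fin n → ℕ) : Law D (opFunctor P) where
  idx := d
  src A := P.ob n ⊗ finTens fun i => P.ob (k i) ⊗ tensPow (k i) (A.obj d).carrier
  map f := P.ob n ◁ tensMap (fun i => P.ob (k i) ◁ tensMap (fun _ => (f.app d).hom)
    (List.finRange (k i))) (List.finRange n)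
  lhs A := P.ob n ◁ tensMap (fun i => (A.obj d).act (k i)) (List.finRange n) ≫ (A.obj d).act n
  rhs A := P.ob n ◁ finTensZip (fun i => P.ob (k i)) (fun i => tensPow (k i) (A.obj d).carrier) ≫
    (α_ _ _ _).inv ≫
    (P.comp k ⊗ₘ finTensFlatten (fun (i : Fin n) (_ : Fin (k i)) => (A.obj d).carrier)) ≫
    (A.obj d).act (∑ i, k i)
  map_lhs f := assoc_lhs_natural P (f.app d) k
  map_rhs f := assoc_rhs_natural P (f.app d) k
  epi_map _ h := epi_whiskerLeft_tensMap _ _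
    (fun _ => epi_whiskerLeft_tensMap _ _ (fun _ => h d) _) _

/-- The unit axiom for algebras over an operad. -/
def unitLaw (P : Operad M) (d : D) : Law D (opFunctor P) where
  idx := d
  src A := (A.obj d).carrier
  map f := (f.app d).hom
  lhs A := (λ_ (A.obj d).carrier).inv ≫ (P.unit ⊗ₘ tensOne (A.obj d).carrier) ≫ (A.obj d).act 1
  rhs A := 𝟙 (A.obj d).carrier
  map_lhs f := unit_lhs_natural P (f.app d)
  map_rhs _ := (Category.comp_id _).trans (Category.id_comp _).symm
  epi_map _ h := h d

/-- The equivariance axiom for algebras over an operad. -/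
def equivarianceLaw (P : Operad M) (d : D) {n : ℕ} (σ : Equiv.Perm (Fin n)) :
    Law D (opFunctor P) where
  idx := d
  src A := P.ob n ⊗ tensPow n (A.obj d).carrier
  map f := P.ob n ◁ tensMap (fun _ => (f.app d).hom) (List.finRange n)
  lhs A := (P.perm σ ⊗ₘ finTensPerm σ (fun _ => (A.obj d).carrier)) ≫ (A.obj d).act n
  rhs A := (A.obj d).act n
  map_lhs f := equivariance_lhs_natural P (f.app d) σ
  map_rhs f := ((f.app d).act_hom n).symm
  epi_map _ h := epi_whiskerLeft_tensMap _ _ (fun _ => h d) _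

/-- The condition imposed on field theories by an orthogonal pair. -/
def perpLaw (P : BipointedOperad M) {d₁ d₂ d : D} (f₁ : d₁ ⟶ d) (f₂ : d₂ ⟶ d) :
    Law D (opFunctor P.toOperad) where
  idx := d
  src A := 𝟙_ M ⊗ ((A.obj d₁).carrier ⊗ (A.obj d₂).carrier)
  map f := 𝟙_ M ◁ ((f.app d₁).hom ⊗ₘ (f.app d₂).hom)
  lhs A := (P.r₁ ⊗ₘ (((A.map f₁).hom ⊗ₘ (A.map f₂).hom) ≫ tensTwo (A.obj d).carrier)) ≫
    (A.obj d).act 2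
  rhs A := (P.r₂ ⊗ₘ (((A.map f₁).hom ⊗ₘ (A.map f₂).hom) ≫ tensTwo (A.obj d).carrier)) ≫
    (A.obj d).act 2
  map_lhs f := perp_natural P.toOperad f P.r₁ f₁ f₂
  map_rhs f := perp_natural P.toOperad f P.r₂ f₁ f₂
  epi_map f h := by
    have h₁ := h d₁
    have h₂ := h d₂
    have := epi_tensorHom (f.app d₁).hom (f.app d₂).hom
    exact inferInstanceAs (Epi ((tensorLeft (𝟙_ M)).map ((f.app d₁).hom ⊗ₘ (f.app d₂).hom)))

/-- The indices for the axioms of a field theory. -/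
inductive AxiomIndex (oD : Orthogonality D) : Type v
  | assoc (d : D) {n : ℕ} (k : Fin n → ℕ)
  | unit (d : D)
  | equivariance (d : D) {n : ℕ} (σ : Equiv.Perm (Fin n))
  | perp {d₁ d₂ d : D} (f₁ : d₁ ⟶ d) (f₂ : d₂ ⟶ d) (h : oD.rel f₁ f₂)

/-- The axioms of a field theory. -/
def axiomLaw (oD : Orthogonality D) (P : BipointedOperad M) :
    AxiomIndex oD → Law D (opFunctor P.toOperad)
  | .assoc d k => assocLaw P.toOperad d k
  | .unit d => unitLaw P.toOperad d
  | .equivariance d σ => equivarianceLaw P.toOperad d σ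
  | .perp f₁ f₂ _ => perpLaw P f₁ f₂

variable {oD : Orthogonality D} {P : BipointedOperad M}

/-- The diagram of operations underlying a field theory. -/
@[reducible]
def FT.toDiagram (𝔄 : FT oD P) : D ⥤ OpAlg (opFunctor P.toOperad) :=
  𝔄.obj ⋙ toOpAlg P.toOperad

lemma FT.toDiagram_axiom (𝔄 : FT oD P) (i : AxiomIndex oD) :
    (axiomLaw oD P i).lhs 𝔄.toDiagram = (axiomLaw oD P i).rhs 𝔄.toDiagram := by
  cases i with
  | assoc d k => exact (𝔄.obj.obj d).assoc k
  | unit d => exact (𝔄.obj.obj d).unit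
  | equivariance d σ => exact (𝔄.obj.obj d).equivariance σ
  | perp f₁ f₂ h => exact 𝔄.property f₁ f₂ h

/-- A diagram of operations satisfying the axioms is a field theory. -/
def FT.ofDiagram (B : D ⥤ OpAlg (opFunctor P.toOperad))
    (h : ∀ i, (axiomLaw oD P i).lhs B = (axiomLaw oD P i).rhs B) : FT oD P where
  obj :=
    { obj := fun d =>
        { carrier := (B.obj d).carrier
          act := (B.obj d).act
          assoc := fun k => h (.assoc d k)
          unit := h (.unit d)
          equivariance := fun σ => h (.equivariance d σ) }
      map := fun f => ⟨(B.map f).hom, (B.map f).act_hom⟩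
      map_id := fun d => by
        ext
        exact congrArg OpAlg.Hom.hom (B.map_id d)
      map_comp := fun f f' => by
        ext
        exact congrArg OpAlg.Hom.hom (B.map_comp f f') }
  property := fun _ _ _ f₁ f₂ hf => h (.perp f₁ f₂ hf)

/-- Morphisms of field theories are morphisms of the underlying diagrams of operations. -/
def FT.homEquiv (𝔄 𝔅 : FT oD P) : (𝔄 ⟶ 𝔅) ≃ (𝔄.toDiagram ⟶ 𝔅.toDiagram) where
  toFun f := Functor.whiskerRight f.hom (toOpAlg P.toOperad)
  invFun f := ObjectProperty.homMk
    { app := fun d => ⟨(f.app d).hom, (f.app d).act_hom⟩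
      naturality := fun d d' e => by
        ext
        exact congrArg OpAlg.Hom.hom (f.naturality e) }
  left_inv _ := rfl
  right_inv _ := rfl

end Laws

/-! ### Left adjoints between categories of field theories -/

section KanExtension

variable {M : Type u} [Category.{v} M] [HasColimits M] {κ : Type w} {g : κ → M ⥤ M}
  [HasColimitsOfShape (Discrete κ) M] [∀ k, PreservesColimitsOfShape ℕ (g k)]
  {C D : Type v} [SmallCategory C] [SmallCategory D] (j : C ⥤ D)

/-- The inclusion of the generators into the diagram of free `OpAlg`s on a left Kan extension. -/
noncomputable def freeLanUnit (G : C ⥤ M) :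
    G ⟶ j ⋙ freeDiagram g (j.lan.obj G) ⋙ OpAlg.forget g :=
  j.lanUnit.app G ≫ Functor.whiskerLeft j (freeDiagramUnit g (j.lan.obj G))

/-- The composite of two adjunctions: left Kan extension against precomposition with `j`, and free
against forgetful. -/
lemma existsUnique_freeLanDesc {G : C ⥤ M} {A : D ⥤ OpAlg g}
    (t : G ⟶ j ⋙ A ⋙ OpAlg.forget g) :
    ∃! h : freeDiagram g (j.lan.obj G) ⟶ A, ∀ c,
      (freeLanUnit j G).app c ≫ (h.app (j.obj c)).hom = t.app c := by
  let e := (j.lanAdjunction M).homEquiv G (A ⋙ OpAlg.forget g)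
  have he : ∀ s, e s = j.lanUnit.app G ≫ Functor.whiskerLeft j s := fun s => by
    rw [← Functor.lanAdjunction_unit]
    exact Adjunction.homEquiv_unit _ _ _ _
  have key : ∀ h : freeDiagram g (j.lan.obj G) ⟶ A,
      (∀ c, (freeLanUnit j G).app c ≫ (h.app (j.obj c)).hom = t.app c) ↔
        freeDiagramUnit g (j.lan.obj G) ≫ Functor.whiskerRight h (OpAlg.forget g) =
          e.symm t := fun h => by
    rw [Equiv.eq_symm_apply, he, NatTrans.ext_iff, funext_iff]
    exact forall_congr' fun c => Iff.of_eq (congrArg (· = t.app c) (Category.assoc _ _ _))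
  obtain ⟨h, hh, hu⟩ := existsUnique_freeDiagramDesc (e.symm t)
  exact ⟨h, (key h).2 hh, fun h' hh' => hu h' ((key h').1 hh')⟩

/-- This is where full faithfulness of `j` enters: the unit of the Kan extension is then invertible,
so the free diagram at `j c` is free on `G c`. -/
lemma freeLan_obj_hom_ext [j.Full] [j.Faithful] {G : C ⥤ M} {c : C} {A : OpAlg g}
    {a b : (freeDiagram g (j.lan.obj G)).obj (j.obj c) ⟶ A}
    (h : (freeLanUnit j G).app c ≫ a.hom = (freeLanUnit j G).app c ≫ b.hom) : a = b := by
  apply freeDiagram_obj_hom_ext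
  rw [← cancel_epi ((j.lanUnit.app G).app c)]
  exact (Category.assoc _ _ _).symm.trans (h.trans (Category.assoc _ _ _))

end KanExtension

/-! ### Universal arrows for restriction combined with change of operad -/

section Adjoints

variable {M : Type u} [Category.{v} M] [MonoidalCategory M] [SymmetricCategory M]
  {C D : Type v} [SmallCategory C] [SmallCategory D] {oC : Orthogonality C}
  {oD : Orthogonality D} {j : C ⥤ D} (hj : IsFullOrthogonalSubcategory oC oD j)
  {P Q : BipointedOperad M} (φ : BipointedOperad.Hom P Q)

/-- Restriction along a full orthogonal subcategory and pullback along a morphism of operads. -/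
@[reducible]
def restrictChange : FT oD Q ⥤ FT oC P := restrict hj Q ⋙ changeOperad oC φ

/-- The components of a morphism into the restriction of a field theory. -/
@[reducible]
def compHom {X : FT oC P} {B : FT oD Q} (f : X ⟶ (restrictChange hj φ).obj B) (c : C) :
    (X.obj.obj c).carrier ⟶ (B.obj.obj (j.obj c)).carrier :=
  (f.hom.app c).hom

lemma compHom_ext {X : FT oC P} {B : FT oD Q} {f f' : X ⟶ (restrictChange hj φ).obj B}
    (h : ∀ c, compHom hj φ f c = compHom hj φ f' c) : f = f' := by
  ext c
  exact h c

/-- The identity morphism of a bipointed operad. -/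
def BipointedOperad.Hom.id (P : BipointedOperad M) : BipointedOperad.Hom P P where
  app n := 𝟙 _
  perm σ := by simp
  comp k := by simp [tensMap_id]
  unit := Category.comp_id _
  map_r₁ := Category.comp_id _
  map_r₂ := Category.comp_id _

lemma isFullOrthogonalSubcategory_id (oC : Orthogonality C) :
    IsFullOrthogonalSubcategory oC oC (𝟭 C) where
  full := inferInstance
  faithful := inferInstance
  rel_iff _ _ := Iff.rfl

lemma tensMap_id_act (A : Alg P.toOperad) (n : ℕ) :
    P.ob n ◁ tensMap (fun _ => 𝟙 A.carrier) (List.finRange n) ≫ A.act n = A.act n := by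
  rw [tensMap_id, MonoidalCategory.whiskerLeft_id, Category.id_comp]

lemma pullback_id_act (A : Alg P.toOperad) (n : ℕ) :
    𝟙 (P.ob n) ▷ tensPow n A.carrier ≫ A.act n = A.act n := by
  rw [MonoidalCategory.id_whiskerRight, Category.id_comp]

/-- Pulling back along the identity morphism of an operad does nothing. -/
def pullbackIdIso (A : Alg P.toOperad) :
    A.pullback (BipointedOperad.Hom.id P).toHom ≅ A where
  hom :=
    { hom := 𝟙 A.carrier
      act_hom := fun n => (Category.comp_id _).trans ((pullback_id_act A n).trans (tensMap_id_act A n).symm) }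
  inv :=
    { hom := 𝟙 A.carrier
      act_hom := fun n => (Category.comp_id _).trans ((tensMap_id_act A n).symm.trans (congrArg _ (pullback_id_act A n).symm)) }
  hom_inv_id := by
    ext
    exact Category.comp_id _
  inv_hom_id := by
    ext
    exact Category.comp_id _

/-- `restrictChange` along the identity morphism of an operad is restriction. -/
def restrictChangeIdIso :
    restrictChange hj (BipointedOperad.Hom.id P) ≅ restrict hj P :=
  NatIso.ofComponents
    (fun 𝔄 => ObjectProperty.isoMk _ (NatIso.ofComponents
      (fun c => pullbackIdIso (𝔄.obj.obj (j.obj c))) (fun f => by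
        ext
        exact (Category.comp_id _).trans (Category.id_comp _).symm)))
    (fun f => by
      ext c
      exact (Category.comp_id _).trans (Category.id_comp _).symm)

variable [MonoidalClosed M] [HasColimits M]

/-- Every field theory admits a universal arrow to `restrictChange`, and the values of its target
at objects of the subcategory are generated by the source. -/
theorem exists_universal_arrow (X : FT oC P) :
    ∃ (B : FT oD Q) (η : X ⟶ (restrictChange hj φ).obj B),
      (∀ {B' : FT oD Q} (f : X ⟶ (restrictChange hj φ).obj B'),
        ∃! h : B ⟶ B', η ≫ (restrictChange hj φ).map h = f) ∧
      ∀ (c : C) {Z : OpAlg (opFunctor Q.toOperad)} (a b : B.toDiagram.obj (j.obj c) ⟶ Z),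
        compHom hj φ η c ≫ a.hom = compHom hj φ η c ≫ b.hom → a = b := by
  have := hj.full
  have := hj.faithful
  have : HasColimitsOfShape (Discrete ℕ) M := inferInstance
  -- Hence the operation functors preserve sequential colimits, as the free construction requires.
  have : IsSifted ℕ := IsFiltered.isSifted
  let G : C ⥤ M := X.toDiagram ⋙ OpAlg.forget _
  let F : D ⥤ OpAlg (opFunctor Q.toOperad) := freeDiagram (opFunctor Q.toOperad) (j.lan.obj G)
  let γ : ∀ c, (X.obj.obj c).carrier ⟶ (F.obj (j.obj c)).carrier := fun c =>
    (freeLanUnit j G).app c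
  -- The relation `a = b` at `(c, n)`: acting by `P(n)` in `X c` and then including the generators
  -- agrees with including first and acting through `φ`.
  let a : ∀ i : C × ℕ, P.ob i.2 ⊗ tensPow i.2 (X.obj.obj i.1).carrier ⟶
      (F.obj (j.obj i.1)).carrier := fun i => (X.obj.obj i.1).act i.2 ≫ γ i.1
  let b : ∀ i : C × ℕ, P.ob i.2 ⊗ tensPow i.2 (X.obj.obj i.1).carrier ⟶
      (F.obj (j.obj i.1)).carrier := fun i =>
    (φ.app i.2 ⊗ₘ tensMap (fun _ => γ i.1) (List.finRange i.2)) ≫ (F.obj (j.obj i.1)).act i.2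
  -- After a morphism `q`, the right-hand side becomes the action pulled back along `φ`, so the
  -- relation states exactly that the generators followed by `q` respect the `P`-actions.
  have hb : ∀ (i : C × ℕ) {A : OpAlg (opFunctor Q.toOperad)} (q : F.obj (j.obj i.1) ⟶ A),
      b i ≫ q.hom = P.ob i.2 ◁ tensMap (fun _ => γ i.1 ≫ q.hom) (List.finRange i.2) ≫
        φ.app i.2 ▷ tensPow i.2 A.carrier ≫ A.act i.2 := fun i A q => by
    simp only [b, Category.assoc]
    rw [q.act_hom, tensMap_comp, MonoidalCategory.whiskerLeft_comp_assoc,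
      MonoidalCategory.whisker_exchange_assoc, MonoidalCategory.tensorHom_def', Category.assoc]
  obtain ⟨B, q, hax, hrel, huniv, hepi⟩ := exists_model (axiomLaw oD Q) (j.lan.obj G)
    (fun i : C × ℕ => j.obj i.1) (fun i => P.ob i.2 ⊗ tensPow i.2 (X.obj.obj i.1).carrier) a b
  have hγ : ∀ {c c' : C} (f : c ⟶ c'), (X.obj.map f).hom ≫ γ c' ≫ (q.app (j.obj c')).hom =
      (γ c ≫ (q.app (j.obj c)).hom) ≫ (B.map (j.map f)).hom := fun {c c'} f => by
    have h₁ : (X.obj.map f).hom ≫ γ c' = γ c ≫ (F.map (j.map f)).hom :=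
      (freeLanUnit j G).naturality f
    have h₂ : (F.map (j.map f)).hom ≫ (q.app (j.obj c')).hom =
        (q.app (j.obj c)).hom ≫ (B.map (j.map f)).hom :=
      congrArg OpAlg.Hom.hom (q.naturality (j.map f))
    rw [← Category.assoc, h₁, Category.assoc, h₂, Category.assoc]
  let 𝔅 : FT oD Q := FT.ofDiagram B hax
  let η : X ⟶ (restrictChange hj φ).obj 𝔅 := ObjectProperty.homMk
    { app := fun c =>
        { hom := γ c ≫ (q.app (j.obj c)).hom
          act_hom := fun n => by
            have h := hrel (c, n)
            rw [hb] at h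
            exact (Category.assoc _ _ _).symm.trans h }
      naturality := fun c c' f => by
        ext
        exact hγ f }
  let e : ∀ 𝔅' : FT oD Q, (𝔅 ⟶ 𝔅') ≃ (B ⟶ 𝔅'.toDiagram) := fun 𝔅' => FT.homEquiv 𝔅 𝔅'
  have hη : ∀ {𝔅' : FT oD Q} (h : 𝔅 ⟶ 𝔅') (c : C),
      compHom hj φ (η ≫ (restrictChange hj φ).map h) c =
        γ c ≫ ((q ≫ e 𝔅' h).app (j.obj c)).hom := fun h c => Category.assoc _ _ _
  refine ⟨𝔅, η, fun {𝔅'} f => ?_, fun c Z x y hxy => ?_⟩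
  -- Extend the underlying natural transformation of `f` to the free diagram. It descends to the
  -- quotient since the target satisfies the axioms and the components of `f` are `P`-algebra
  -- morphisms.
  · obtain ⟨s, hs, hs'⟩ := existsUnique_freeLanDesc j (A := 𝔅'.toDiagram) (G := G)
      { app := fun c => compHom hj φ f c
        naturality := fun c c' e => congrArg Alg.Hom.hom (f.hom.naturality e) }
    have hs₀ : ∀ c, γ c ≫ (s.app (j.obj c)).hom = compHom hj φ f c := hs
    obtain ⟨h, hh, hh'⟩ := huniv s (FT.toDiagram_axiom 𝔅') fun i => by
      rw [hb, hs₀]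
      have : a i ≫ (s.app (j.obj i.1)).hom = (X.obj.obj i.1).act i.2 ≫ compHom hj φ f i.1 := by
        rw [← hs₀]
        exact Category.assoc _ _ _
      rw [this]
      exact (f.hom.app i.1).act_hom i.2
    refine ⟨(e 𝔅').symm h, compHom_ext hj φ fun c => ?_, fun h' hf => ?_⟩
    · rw [hη, Equiv.apply_symm_apply, hh, hs₀]
    · rw [Equiv.eq_symm_apply]
      refine hh' _ (hs' _ fun c => ?_)
      refine Eq.trans (hη h' c).symm ?_
      rw [hf]
  -- Cancel the epimorphism `q` at `j c`, then use that the free diagram at `j c` is generated by `X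
  -- c`.
  · have := hepi (j.obj c)
    have hq : q.app (j.obj c) ≫ x = q.app (j.obj c) ≫ y := by
      apply freeLan_obj_hom_ext j
      exact (Category.assoc _ _ _).symm.trans (hxy.trans (Category.assoc _ _ _))
    exact OpAlg.hom_ext _ _
      ((cancel_epi (q.app (j.obj c)).hom).1 (congrArg OpAlg.Hom.hom hq))

instance isRightAdjoint_restrictChange : (restrictChange hj φ).IsRightAdjoint := by
  rw [isRightAdjoint_iff_hasInitial_structuredArrow]
  intro X
  obtain ⟨B, η, h, -⟩ := exists_universal_arrow hj φ X
  refine IsInitial.hasInitial (X := StructuredArrow.mk η) ?_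
  exact IsInitial.ofUniqueHom
    (fun A => StructuredArrow.homMk (h A.hom).choose (h A.hom).choose_spec.1)
    fun A m => StructuredArrow.hom_ext _ _
      ((h A.hom).choose_spec.2 m.right (StructuredArrow.w m))

/-- The case of the identity functor, where the two right adjoints agree definitionally. -/
lemma changeOperad_isRightAdjoint : (changeOperad oC φ).IsRightAdjoint :=
  Functor.isRightAdjoint_of_iso
    (F := restrictChange (isFullOrthogonalSubcategory_id oC) φ) (Iso.refl _)

lemma restrict_isRightAdjoint : (restrict hj P).IsRightAdjoint :=
  Functor.isRightAdjoint_of_iso (restrictChangeIdIso hj)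

end Adjoints

/-! ### Local field theories -/

section Local

/-- If the unit of an adjunction is an epimorphism at `X`, then the counit is an isomorphism at the
image of `X` under the left adjoint. -/
lemma isIso_counit_app_of_epi_unit_app {V N : Type*} [Category V] [Category N] {L : N ⥤ V}
    {R : V ⥤ N} (adj : L ⊣ R) (X : N) [Epi (adj.unit.app X)] :
    IsIso (adj.counit.app (L.obj X)) := by
  have : L.PreservesEpimorphisms := Functor.preservesEpimorphisms_of_adjunction adj
  have h := adj.left_triangle_components X
  -- The counit is the retraction, by the triangle identity; together with epimorphy this makes it
  -- the inverse.
  have : IsSplitMono (L.map (adj.unit.app X)) := ⟨⟨⟨_, h⟩⟩⟩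
  have : IsIso (L.map (adj.unit.app X)) := isIso_of_epi_of_isSplitMono _
  have h' : adj.counit.app (L.obj X) = inv (L.map (adj.unit.app X)) := by
    rw [← cancel_epi (L.map (adj.unit.app X)), h, IsIso.hom_inv_id]
    rfl
  rw [h']
  infer_instance

variable {M : Type u} [Category.{v} M] [MonoidalCategory M] [SymmetricCategory M]
  [MonoidalClosed M] [HasColimits M]
  {C D : Type v} [SmallCategory C] [SmallCategory D] {oC : Orthogonality C}
  {oD : Orthogonality D} {j : C ⥤ D} (hj : IsFullOrthogonalSubcategory oC oD j)
  {P : BipointedOperad M}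

/-- The case of the identity operad morphism: morphisms out of the restriction are tested objectwise
on `C`, where the target is generated by `X`. -/
lemma exists_epi_universal_arrow (X : FT oC P) :
    ∃ (B : FT oD P) (η : X ⟶ (restrict hj P).obj B), Epi η ∧
      ∀ {B' : FT oD P} (f : X ⟶ (restrict hj P).obj B'),
        ∃ h : B ⟶ B', η ≫ (restrict hj P).map h = f := by
  obtain ⟨B, η, h, h'⟩ := exists_universal_arrow hj (BipointedOperad.Hom.id P) X
  refine ⟨B, η ≫ (restrictChangeIdIso hj).hom.app B, ⟨fun {W} x y hxy => ?_⟩, fun {B'} f => ?_⟩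
  · ext c
    have hc : ∀ z : (restrict hj P).obj B ⟶ W,
        (((η ≫ (restrictChangeIdIso hj).hom.app B) ≫ z).hom.app c).hom =
          compHom hj (BipointedOperad.Hom.id P) η c ≫ (z.hom.app c).hom := fun z =>
      congrArg (· ≫ (z.hom.app c).hom)
        (Category.comp_id (compHom hj (BipointedOperad.Hom.id P) η c))
    exact congrArg OpAlg.Hom.hom (h' c ((toOpAlg P.toOperad).map (x.hom.app c))
      ((toOpAlg P.toOperad).map (y.hom.app c)) ((hc x).symm.trans
        ((congrArg (fun t : X ⟶ W => (t.hom.app c).hom) hxy).trans (hc y))))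
  · obtain ⟨k, hk, -⟩ := h (f ≫ (restrictChangeIdIso hj).inv.app B')
    refine ⟨k, ?_⟩
    rw [Category.assoc, ← (restrictChangeIdIso hj).hom.naturality, ← Category.assoc, hk,
      Category.assoc, Iso.inv_hom_id_app, Category.comp_id]

/-- Transfers epimorphy from the constructed arrow `η` to the unit of an arbitrary adjunction. The
unit is `η` followed by the restriction of some `k`, and `k` has a section `l` because `l ≫ k` fixes
the unit; so the unit is an epimorphism followed by a split epimorphism. -/
lemma epi_unit_app_of_adjunction {L : FT oC P ⥤ FT oD P} (adj : L ⊣ restrict hj P)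
    (X : FT oC P) : Epi (adj.unit.app X) := by
  obtain ⟨B, η, hη, h⟩ := exists_epi_universal_arrow hj X
  obtain ⟨k, hk⟩ := h (adj.unit.app X)
  let l : L.obj X ⟶ B := (adj.homEquiv _ _).symm η
  have hl : adj.unit.app X ≫ (restrict hj P).map l = η := by
    exact (adj.homEquiv_unit _ _ _).symm.trans (Equiv.apply_symm_apply _ _)
  have hlk : l ≫ k = 𝟙 _ := by
    apply (adj.homEquiv _ _).injective
    rw [Adjunction.homEquiv_unit, Adjunction.homEquiv_unit, Functor.map_comp, ← Category.assoc, hl,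
      hk, CategoryTheory.Functor.map_id]
    exact (Category.comp_id _).symm
  refine ⟨fun x y hxy => ?_⟩
  rw [← hk, Category.assoc, Category.assoc, cancel_epi] at hxy
  have h' := congrArg ((restrict hj P).map l ≫ ·) hxy
  simpa only [← Category.assoc, ← Functor.map_comp, hlk, CategoryTheory.Functor.map_id, Category.id_comp] using h'

variable {Q : BipointedOperad M} (φ : BipointedOperad.Hom P Q)

theorem isLocal_leftAdjoint_obj {L : FT oD P ⥤ FT oD Q} (adj : L ⊣ changeOperad oD φ)
    {𝔄 : FT oD P} (h𝔄 : IsLocal hj 𝔄) : IsLocal hj (L.obj 𝔄) := by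
  obtain ⟨L₀, adj₀, h₀⟩ := h𝔄
  have := changeOperad_isRightAdjoint (oC := oC) φ
  have := restrict_isRightAdjoint hj (P := Q)
  let adjC := Adjunction.ofIsRightAdjoint (changeOperad oC φ)
  let adjQ := Adjunction.ofIsRightAdjoint (restrict hj Q)
  -- Both composites are left adjoint to the same functor: restricting and changing the operad
  -- commute definitionally, hence `Iso.refl`.
  let e : L₀ ⋙ L ≅ (changeOperad oC φ).leftAdjoint ⋙ (restrict hj Q).leftAdjoint :=
    Adjunction.leftAdjointUniq (adj₀.comp adj)
      (Adjunction.ofNatIsoRight (adjC.comp adjQ) (Iso.refl _))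
  -- Locality of `𝔄` places `L.obj 𝔄` in the essential image of `j_!`; invertibility of the counit
  -- is then transported along this isomorphism.
  let i := (L.mapIso (asIso (adj₀.counit.app 𝔄))).symm ≪≫ e.app ((restrict hj P).obj 𝔄)
  refine ⟨_, adjQ, ?_⟩
  have := epi_unit_app_of_adjunction hj adjQ
    ((changeOperad oC φ).leftAdjoint.obj ((restrict hj P).obj 𝔄))
  exact (NatTrans.isIso_app_iff_of_iso adjQ.counit i).2 (isIso_counit_app_of_epi_unit_app adjQ _)

end Local

end OperadicFT

/-! ### The main theorem -/

theorem proposition4p8 {M : Type u} [Category.{v} M] [MonoidalCategory M] [SymmetricCategory M]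
    [MonoidalClosed M] [HasLimits M] [HasColimits M]
    {C D : Type v} [SmallCategory C] [SmallCategory D]
    (oC : OperadicFT.Orthogonality C) (oD : OperadicFT.Orthogonality D) (j : C ⥤ D)
    (hj : OperadicFT.IsFullOrthogonalSubcategory oC oD j)
    (P Q : OperadicFT.BipointedOperad M) (φ : OperadicFT.BipointedOperad.Hom P Q)
    (W : MorphismProperty C) :
    -- the adjunctions `(φ^*)^! ⊣ (φ^*)_*` (on `D` and on `C`) and `j_! ⊣ j^*` exist
    ((OperadicFT.changeOperad oD φ).IsRightAdjoint ∧
      (OperadicFT.changeOperad oC φ).IsRightAdjoint ∧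
      (OperadicFT.restrict hj P).IsRightAdjoint ∧
      (OperadicFT.restrict hj Q).IsRightAdjoint) ∧
    -- the left adjoint `(φ^*)^!` preserves `j`-local field theories
    (∀ (L : OperadicFT.FT oD P ⥤ OperadicFT.FT oD Q), (L ⊣ OperadicFT.changeOperad oD φ) →
      ∀ 𝔄 : OperadicFT.FT oD P, OperadicFT.IsLocal hj 𝔄 → OperadicFT.IsLocal hj (L.obj 𝔄)) ∧
    -- the right adjoint `(φ^*)_*` preserves `W`-constant field theories
    (∀ 𝔅 : OperadicFT.FT oC Q, OperadicFT.IsConstantOn W 𝔅 →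
      OperadicFT.IsConstantOn W ((OperadicFT.changeOperad oC φ).obj 𝔅)) := by
  refine ⟨⟨OperadicFT.changeOperad_isRightAdjoint φ, OperadicFT.changeOperad_isRightAdjoint φ,
    OperadicFT.restrict_isRightAdjoint hj, OperadicFT.restrict_isRightAdjoint hj⟩,
    fun L adj 𝔄 h𝔄 => OperadicFT.isLocal_leftAdjoint_obj hj φ adj h𝔄, fun 𝔅 h𝔅 c c' f hf => ?_⟩
  have := h𝔅 f hf
  exact inferInstanceAs (IsIso ((OperadicFT.pullbackAlg φ.toHom).map (𝔅.obj.map f)))
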